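/- Let $T>0$, let $(\Omega,\mathcal F,\mathbb P)$ be a probability space with a right-continuous complete filtration $(\mathcal F_t)_{t\ge0}$, and let $J$ be a random variable with $\mathbb E(J^2)<\infty$. Let $0<\tau_1<\tau_2<\cdots$ be stopping times, finitely many of which lie in $[0,T]$; each arrival $\tau_n$ carries a type $\varepsilon_n\in\{+,-\}$ and a mark (jump size) $J_n>0$, both $\mathcal F_{\tau_n}$-measurable, and the $J_n$ are i.i.d. with the law of $J$. For $i\in\{+,-\}$ let $N^i(dt,dx)$ be the random measure on $[0,T]\times\mathbb R$ that puts a unit mass at $(\tau_n,J_n)$ for each $n$ with $\varepsilon_n=i$, $\tau_n\le T$, and put $$f^{\pm}_t=\sum_{n:\ \tau_n\le t,\ \varepsilon_n=\pm}J_n ,\qquad f_t=f_0+f^+_t-f^-_t ,\quad f_0\in\mathbb R .$$ Assume that these points form a bivariate marked Hawkes process with exponential baseline and cross-exciting exponential kernel: with $$\lambda^{\pm}_t=\mu_0e^{\kappa t/T}+\sum_{n:\ \tau_n\le t,\ \varepsilon_n=\mp}\alpha e^{-\beta(t-\tau_n)}J_n ,\qquad \mu_0,\kappa,\alpha,\beta>0,\quad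 \alpha\,\mathbb E(J)<\beta ,$$ the measure $N^{i}(dt,dx)$ has compensator $\lambda^{i}_t\,dt\otimes\mathbb P_J(dx)$ on $[0,T]$ (where $\mathbb P_J$ is the law of $J$), i.e. $\mathbb E\int W\,dN^i=\mathbb E\int_0^T\!\int W(t,\cdot,x)\,\mathbb P_J(dx)\,\lambda^i_t\,dt$ for every predictable $W\ge0$. Write $m=\mathbb E(J)$ and $m_2=\mathbb E(J^2)$. Then for every $u\in[0,T]$, $\lambda^+_u$ is integrable, $f_u$ is square integrable, and $$\mathbb E(\lambda^+_u)=\mu_0\Big(\tfrac{\beta+\kappa/T}{\beta-\alpha m+\kappa/T}\,e^{\kappa u/T}-\tfrac{\alpha m}{\beta-\alpha m+\kappa/T}\,e^{-(\beta-\alpha m)u}\Big),$$ $$\mathbb E(f_u^2)=f_0^2+2\mu_0m_2\Big((C_1+C_2+C_3+C_4)e^{\kappa u/T}-C_1e^{-(\beta-\alpha m)u}-C_2e^{-2(\beta+\alpha m)u}-C_3e^{-(\beta+\alpha m)u}-C_4\Big),$$ where $$C_1=\tfrac{-\alpha^2m^2}{(\beta-\alpha m)(\beta+3\alpha m)(\beta-\alpha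 m+\kappa/T)},\qquad C_2=\tfrac{\alpha^2m^2(\beta+2\alpha m)}{(\beta+\alpha m)^2(\beta+3\alpha m)(2\beta+2\alpha m+\kappa/T)},$$ $$C_3=\tfrac{\alpha\beta m}{(\beta+\alpha m)^2(\beta+\alpha m+\kappa/T)},\qquad C_4=\tfrac{\beta^3}{(\kappa/T)(\beta+\alpha m)^2(\beta-\alpha m)} .$$ The function $u\mapsto\mathbb E(f_u^2)$ is differentiable on $[0,T]$ (one-sidedly at the end points), and for all $0\le s<t\le T$, $$\mathbb E\big((f_t-f_s)^2\big)=\mathbb E(f_t^2)-\mathbb E(f_s^2)-\frac{1-e^{-(\beta+\alpha m)(t-s)}}{\beta+\alpha m}\Big(\frac{d\,\mathbb E(f_u^2)}{du}(s)-2m_2\,\mathbb E(\lambda^+_s)\Big).$$ Consequently, for $0<t\le T$ and $\delta>0$, the signature plot $C(t,\delta)=\frac1t\mathbb E\big(\sum_{i=1}^{\lfloor t/\delta\rfloor}(f_{i\delta}-f_{(i-1)\delta})^2\big)$ satisfies $$C(t,\delta)=\frac1t\Big(\mathbb E\big(f^2_{\lfloor t/\delta\rfloor\delta}\big)-f_0^2\Big)-\frac1t\,\frac{1-e^{-(\beta+\alpha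 m)\delta}}{\beta+\alpha m}\sum_{i=0}^{\lfloor t/\delta\rfloor-1}\Big(\frac{d\,\mathbb E(f_u^2)}{du}(i\delta)-2m_2\,\mathbb E(\lambda^+_{i\delta})\Big).$$ -/

import Mathlib

open MeasureTheory ProbabilityTheory
open scoped NNReal ENNReal

noncomputable section

namespace MarkedHawkes

/-! A bivariate marked point process is given by its arrival times `τ n`, the type `ε n` of each
arrival (`0` for an upward jump `+`, `1` for a downward jump `-`) and its mark `ξ n`
(the jump size). Arrivals are enumerated from `n = 0`. -/

variable {Ω : Type*}

open Classical in
/-- `∫₀ᵗ h(s) J_s dNⁱ_s`, the sum of `ξ n * h (τ n)` over the arrivals of type `i` up to time `t`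
(a finite sum as soon as there are finitely many arrivals up to time `t`). -/
def markIntegral (τ : ℕ → Ω → ℝ≥0) (ε : ℕ → Ω → Fin 2) (ξ : ℕ → Ω → ℝ)
    (i : Fin 2) (h : ℝ → ℝ) (t : ℝ) (ω : Ω) : ℝ :=
  ∑' n, if (τ n ω : ℝ) ≤ t ∧ ε n ω = i then ξ n ω * h (τ n ω) else 0

/-- The intensity `λⁱ_t = μ(t/T) + ∑ⱼ ∫₀ᵗ φᵢⱼ(t - s) J_s dNʲ_s`. -/
def intensity (T : ℝ) (μ : ℝ → ℝ) (φ : ℝ → Matrix (Fin 2) (Fin 2) ℝ)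
    (τ : ℕ → Ω → ℝ≥0) (ε : ℕ → Ω → Fin 2) (ξ : ℕ → Ω → ℝ)
    (i : Fin 2) (t : ℝ) (ω : Ω) : ℝ :=
  μ (t / T) + ∑ j : Fin 2, markIntegral τ ε ξ j (fun s => φ (t - s) i j) t ω

/-- The processes `f⁺` (for `i = 0`) and `f⁻` (for `i = 1`): `fⁱ_t = ∫₀ᵗ J_s dNⁱ_s`. -/
def jumpSum (τ : ℕ → Ω → ℝ≥0) (ε : ℕ → Ω → Fin 2) (ξ : ℕ → Ω → ℝ)
    (i : Fin 2) (t : ℝ) (ω : Ω) : ℝ :=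
  markIntegral τ ε ξ i (fun _ => 1) t ω

/-- The price `f_t = f₀ + f⁺_t - f⁻_t`. -/
def price (f₀ : ℝ) (τ : ℕ → Ω → ℝ≥0) (ε : ℕ → Ω → Fin 2) (ξ : ℕ → Ω → ℝ)
    (t : ℝ) (ω : Ω) : ℝ :=
  f₀ + jumpSum τ ε ξ 0 t ω - jumpSum τ ε ξ 1 t ω

open Classical in
/-- `(τ, ε, ξ)` is, on `[0, T]`, a bivariate marked Hawkes process with baseline `μ(·/T)` and kernel
matrix `φ`, with respect to the filtration `ℱ`, with marks distributed as `J`. -/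
structure IsMarkedHawkes [mΩ : MeasurableSpace Ω] (P : Measure Ω) (ℱ : Filtration ℝ≥0 mΩ)
    (T : ℝ) (μ : ℝ → ℝ) (φ : ℝ → Matrix (Fin 2) (Fin 2) ℝ)
    (τ : ℕ → Ω → ℝ≥0) (ε : ℕ → Ω → Fin 2) (ξ : ℕ → Ω → ℝ) (J : Ω → ℝ) : Prop where
  /-- The filtration is right continuous. -/
  rightContinuous : ℱ.IsRightContinuous
  /-- The filtration is complete. -/
  complete : ∀ A : Set Ω, P A = 0 → MeasurableSet[ℱ 0] A
  /-- `0 < τ₀ < τ₁ < ⋯`. -/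
  tau_pos : ∀ ω, 0 < τ 0 ω
  tau_strictMono : ∀ ω, StrictMono fun n => τ n ω
  /-- Finitely many arrivals on `[0, T]`. -/
  locallyFinite : ∀ ω, {n | (τ n ω : ℝ) ≤ T}.Finite
  /-- Arrival times are stopping times. -/
  isStoppingTime : ∀ n, IsStoppingTime ℱ fun ω => ((τ n ω : ℝ≥0) : WithTop ℝ≥0)
  /-- The type and the mark of an arrival are known at its arrival. -/
  type_measurable : ∀ n, Measurable[(isStoppingTime n).measurableSpace] (ε n)
  mark_measurable : ∀ n, Measurable[(isStoppingTime n).measurableSpace] (ξ n)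
  /-- The marks are positive, independent and distributed as `J`, and `E(J²) < ∞`. -/
  mark_pos : ∀ n ω, 0 < ξ n ω
  mark_iIndepFun : iIndepFun ξ P
  mark_identDistrib : ∀ n, IdentDistrib (ξ n) J P P
  memLp_two : MemLp J 2 P
  /-- On `[0, T]` the jump measure `Nⁱ(dt, dx)` of the arrivals of type `i` has compensator
  `λⁱ_t dt ⊗ law(J)(dx)`: both have the same integral against every nonnegative predictable
  function `W(t, ω, x)`. -/
  compensator : ∀ (i : Fin 2) (W : (ℝ≥0 × Ω) × ℝ → ℝ≥0∞),
    Measurable[ℱ.predictable.prod (borel ℝ)] W →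
    ∫⁻ ω, (∑' n, if (τ n ω : ℝ) ≤ T ∧ ε n ω = i then W ((τ n ω, ω), ξ n ω) else 0) ∂P =
      ∫⁻ ω, (∫⁻ t in Set.Icc (0 : ℝ) T, (∫⁻ x, W ((t.toNNReal, ω), x) ∂(P.map J)) *
        ENNReal.ofReal (intensity T μ φ τ ε ξ i t ω)) ∂P

/-- The exponential baseline `μ(t) = μ₀ e^{κ t}`. -/
def expBaseline (μ₀ κ : ℝ) (t : ℝ) : ℝ := μ₀ * Real.exp (κ * t)

/-- The antidiagonal kernel matrix with entries `t ↦ α e^{-β t}`. -/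
def expKernel (α β : ℝ) (t : ℝ) : Matrix (Fin 2) (Fin 2) ℝ :=
  !![0, α * Real.exp (-β * t); α * Real.exp (-β * t), 0]

/-- The closed form of `E(λ⁺_t)`, where `m = E(J)`. -/
def meanIntensity (T μ₀ κ α β m t : ℝ) : ℝ :=
  μ₀ * ((β + κ / T) / (β - α * m + κ / T) * Real.exp (κ * (t / T))
    - α * m / (β - α * m + κ / T) * Real.exp (-(β - α * m) * t))

def C₁ (T κ α β m : ℝ) : ℝ :=
  -(α ^ 2 * m ^ 2) / ((β - α * m) * (β + 3 * α * m) * (β - α * m + κ / T))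

def C₂ (T κ α β m : ℝ) : ℝ :=
  α ^ 2 * m ^ 2 * (β + 2 * α * m) /
    ((β + α * m) ^ 2 * (β + 3 * α * m) * (2 * β + 2 * α * m + κ / T))

def C₃ (T κ α β m : ℝ) : ℝ :=
  α * β * m / ((β + α * m) ^ 2 * (β + α * m + κ / T))

def C₄ (T κ α β m : ℝ) : ℝ :=
  β ^ 3 / (κ / T * (β + α * m) ^ 2 * (β - α * m))

/-- The closed form of `E(f_t²)`, where `m = E(J)` and `m₂ = E(J²)`. -/
def secondMoment (T μ₀ κ α β m m₂ f₀ t : ℝ) : ℝ :=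
  f₀ ^ 2 + 2 * μ₀ * m₂ *
    ((C₁ T κ α β m + C₂ T κ α β m + C₃ T κ α β m + C₄ T κ α β m) * Real.exp (κ * (t / T))
      - C₁ T κ α β m * Real.exp (-(β - α * m) * t)
      - C₂ T κ α β m * Real.exp (-2 * (β + α * m) * t)
      - C₃ T κ α β m * Real.exp (-(β + α * m) * t)
      - C₄ T κ α β m)

/-- The signature plot `C(t, δ) = (1/t) E(∑_{i=1}^{⌊t/δ⌋} (f_{iδ} - f_{(i-1)δ})²)`. -/
def signaturePlot [MeasurableSpace Ω] (P : Measure Ω) (f : ℝ → Ω → ℝ) (t δ : ℝ) : ℝ :=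
  1 / t * ∫ ω, (∑ i ∈ Finset.Icc 1 ⌊t / δ⌋₊, (f (i * δ) ω - f (((i : ℝ) - 1) * δ) ω) ^ 2) ∂P

end MarkedHawkes

end

noncomputable section

namespace MarkedHawkes

/-! The system closes after two changes of variable. Because the kernel is exponential, the
intensities are functions of sums over the arrivals. Let X be the signed sum of the marks (so f = f₀
+ X), and let Y and S be the signed and unsigned sums with weights e^{βτ}. Then λ⁺ - λ⁻ = -α e^{-βt}
Y and λ⁺ + λ⁻ = 2μ₀ e^{κt/T} + α e^{-βt} S. Write m, m₂ for the first two moments of J.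

The compensator formula turns expectations of sums over arrivals into time integrals of expected
intensities (`integral_pointSum_eq`). Combined with integration by parts for jump sums, it gives
mixed second moments (`integral_markSum_mul_markSum`). The result is a triangular family of scalar
linear integral equations: E(S) and E(Y) each solve their own equation, with E(Y) = 0; E(Y²) is
driven by E(λ⁺); E(XY) is driven by E(Y²) and E(λ⁺); and E(X²) is an integral of E(XY) and E(λ⁺).
Each bounded solution is identified with an explicit one by Grönwall uniqueness
(`eqOn_of_integral_eq`), and the constants come out of `exists_second_moments`.

These manipulations need the total mark on [0, T] to be square integrable (`memLp_pointSum`). The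
sum is truncated after finitely many arrivals, a Grönwall estimate uniform in the truncation is
proved, and Fatou's lemma removes the truncation. All processes are then dominated by powers of 1 +
total mark (`IsDominated`).

For increments, (X_t - X_s)² = X_t² - X_s² - 2 X_s (X_t - X_s). For fixed s, the map r ↦ E(X_s Y_r)
solves y' = -αm y, so E(X_s (X_t - X_s)) is -αm e^{-βs} E(X_s Y_s) times the integral of
e^{-(β+αm)(r-s)} over [s, t]. The factor -2αm e^{-βs} E(X_s Y_s) is exactly the derivative of E(f²)
at s minus 2m₂ E(λ⁺_s). The signature plot follows by telescoping. -/

/-! ### Sums over the points of a locally finite sequence -/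

/-- The sum of the weights `v n` over the points `τ n ≤ t`. -/
def pointSum (τ v : ℕ → ℝ) (t : ℝ) : ℝ := ∑' n, if τ n ≤ t then v n else 0

/-- The sum of the weights `v n` over the points `τ n < t`. -/
def leftSum (τ v : ℕ → ℝ) (t : ℝ) : ℝ := ∑' n, if τ n < t then v n else 0

section Deterministic

variable {τ v w : ℕ → ℝ} {t T : ℝ} {K : ℕ}

/-- The points up to t have the indices of an initial segment, which turns every series over points
into a sum over `Finset.range K`. -/
lemma exists_count (hτ : StrictMono τ) (hfin : {n | τ n ≤ t}.Finite) :
    ∃ K, ∀ n, τ n ≤ t ↔ n < K := by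
  obtain ⟨k, hk⟩ := hfin.exists_notMem
  have hex : ∃ n, t < τ n := ⟨k, by simpa using hk⟩
  refine ⟨Nat.find hex, fun n => ⟨fun h => ?_, fun h => ?_⟩⟩
  · by_contra! hn
    exact absurd ((Nat.find_spec hex).trans_le (hτ.monotone hn)) (not_lt.2 h)
  · simpa using Nat.find_min hex h

lemma pointSum_eq_sum_range (hK : ∀ n, τ n ≤ t → n < K) :
    pointSum τ v t = ∑ n ∈ Finset.range K, if τ n ≤ t then v n else 0 := by
  refine tsum_eq_sum fun n hn => if_neg fun h => hn ?_
  simpa using hK n h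

lemma leftSum_eq_sum_range (hK : ∀ n, τ n < t → n < K) :
    leftSum τ v t = ∑ n ∈ Finset.range K, if τ n < t then v n else 0 := by
  refine tsum_eq_sum fun n hn => if_neg fun h => hn ?_
  simpa using hK n h

/-- One K serves all weights, so identities between several point sums can be checked term by term.
-/
lemma exists_forall_pointSum_eq (hτ : StrictMono τ) (hfin : {n | τ n ≤ T}.Finite) (htT : t ≤ T) :
    ∃ K, ∀ v, pointSum τ v t = ∑ n ∈ Finset.range K, if τ n ≤ t then v n else 0 := by
  obtain ⟨K, hK⟩ := exists_count hτ hfin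
  exact ⟨K, fun v => pointSum_eq_sum_range fun n hn => (hK n).1 (hn.trans htT)⟩

lemma leftSum_apply_point (hτ : StrictMono τ) (n : ℕ) :
    leftSum τ v (τ n) = ∑ k ∈ Finset.range n, v k := by
  rw [leftSum_eq_sum_range (K := n) fun k hk => hτ.lt_iff_lt.1 hk]
  exact Finset.sum_congr rfl fun k hk => if_pos (hτ (by simpa using hk))

/-- Integration by parts for sums over points. -/
lemma pointSum_mul_pointSum (hτ : StrictMono τ) (hfin : {n | τ n ≤ T}.Finite) (htT : t ≤ T) :
    pointSum τ v t * pointSum τ w t =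
      pointSum τ (fun n => leftSum τ v (τ n) * w n + leftSum τ w (τ n) * v n + v n * w n) t := by
  obtain ⟨K, hK⟩ := exists_forall_pointSum_eq hτ hfin htT
  simp only [hK]
  clear hK
  induction K with
  | zero => simp
  | succ k ih =>
    simp only [Finset.sum_range_succ]
    rw [← ih]
    by_cases h : τ k ≤ t
    -- Before the k-th point is added, each partial sum is the left limit at that point, so the step
    -- is the expansion of (a + x)(b + y).
    · have hl : ∀ v : ℕ → ℝ, ∑ n ∈ Finset.range k, (if τ n ≤ t then v n else 0)
          = leftSum τ v (τ k) := fun v => by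
        rw [leftSum_apply_point hτ]
        refine Finset.sum_congr rfl fun j hj => if_pos (le_trans ?_ h)
        exact hτ.monotone (Finset.mem_range.1 hj).le
      simp only [hl, if_pos h]
      ring
    · simp [h]

lemma pointSum_add (hτ : StrictMono τ) (hfin : {n | τ n ≤ T}.Finite) (htT : t ≤ T) :
    pointSum τ (fun n => v n + w n) t = pointSum τ v t + pointSum τ w t := by
  obtain ⟨K, hK⟩ := exists_forall_pointSum_eq hτ hfin htT
  simp only [hK, ← Finset.sum_add_distrib]
  exact Finset.sum_congr rfl fun n _ => by split_ifs <;> simp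

lemma pointSum_sub (hτ : StrictMono τ) (hfin : {n | τ n ≤ T}.Finite) (htT : t ≤ T) :
    pointSum τ (fun n => v n - w n) t = pointSum τ v t - pointSum τ w t := by
  obtain ⟨K, hK⟩ := exists_forall_pointSum_eq hτ hfin htT
  simp only [hK, ← Finset.sum_sub_distrib]
  exact Finset.sum_congr rfl fun n _ => by split_ifs <;> simp

lemma pointSum_nonneg (hv : ∀ n, 0 ≤ v n) : 0 ≤ pointSum τ v t :=
  tsum_nonneg fun n => by split_ifs <;> simp [hv]

lemma abs_pointSum_le (hτ : StrictMono τ) (hfin : {n | τ n ≤ T}.Finite) (htT : t ≤ T)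
    (hvw : ∀ n, τ n ≤ T → |v n| ≤ w n) : |pointSum τ v t| ≤ pointSum τ w T := by
  obtain ⟨K, hK⟩ := exists_count hτ hfin
  rw [pointSum_eq_sum_range (K := K) fun n hn => (hK n).1 (hn.trans htT),
    pointSum_eq_sum_range fun n => (hK n).1]
  refine (Finset.abs_sum_le_sum_abs _ _).trans (Finset.sum_le_sum fun n hn => ?_)
  have h := (hK n).2 (Finset.mem_range.1 hn)
  have := hvw n h
  have := abs_nonneg (v n)
  split_ifs <;> simp <;> linarith

lemma abs_leftSum_le (hτ : StrictMono τ) (hfin : {n | τ n ≤ T}.Finite) (htT : t ≤ T)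
    (hvw : ∀ n, τ n ≤ T → |v n| ≤ w n) : |leftSum τ v t| ≤ pointSum τ w T := by
  obtain ⟨K, hK⟩ := exists_count hτ hfin
  rw [leftSum_eq_sum_range (K := K) fun n hn => (hK n).1 (hn.le.trans htT),
    pointSum_eq_sum_range fun n => (hK n).1]
  refine (Finset.abs_sum_le_sum_abs _ _).trans (Finset.sum_le_sum fun n hn => ?_)
  have h := (hK n).2 (Finset.mem_range.1 hn)
  have := hvw n h
  have := abs_nonneg (v n)
  split_ifs <;> simp <;> linarith

lemma leftSum_nonneg (hv : ∀ n, 0 ≤ v n) : 0 ≤ leftSum τ v t :=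
  tsum_nonneg fun n => by split_ifs <;> simp [hv]

lemma leftSum_le_pointSum (hτ : StrictMono τ) (hfin : {n | τ n ≤ T}.Finite) (htT : t ≤ T)
    (hv : ∀ n, 0 ≤ v n) : leftSum τ v t ≤ pointSum τ v t := by
  obtain ⟨K, hK⟩ := exists_count hτ hfin
  rw [leftSum_eq_sum_range (K := K) fun n hn => (hK n).1 (hn.le.trans htT),
    pointSum_eq_sum_range fun n hn => (hK n).1 (hn.trans htT)]
  refine Finset.sum_le_sum fun n _ => ?_
  have := hv n
  split_ifs <;> linarith

lemma leftSum_eq_pointSum_of_notMem_range (ht : t ∉ Set.range τ) :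
    leftSum τ v t = pointSum τ v t := by
  refine tsum_congr fun n => ?_
  have : τ n < t ↔ τ n ≤ t := ⟨le_of_lt, fun h => lt_of_le_of_ne h fun h' => ht ⟨n, h'⟩⟩
  simp [this]

/-- The two sums differ only at the countably many points; under dt, the predictable left limit may
thus replace the process itself. -/
lemma ae_leftSum_eq_pointSum (τ : ℕ → ℝ) :
    ∀ᵐ t : ℝ, ∀ v, leftSum τ v t = pointSum τ v t := by
  filter_upwards [(Set.countable_range τ).ae_notMem volume] with t ht v
    using leftSum_eq_pointSum_of_notMem_range ht

lemma ofReal_pointSum (hfin : {n | τ n ≤ T}.Finite) (htT : t ≤ T)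
    (hv : ∀ n, 0 ≤ v n) :
    ENNReal.ofReal (pointSum τ v t) = ∑' n, if τ n ≤ t then ENNReal.ofReal (v n) else 0 := by
  have hs : Summable fun n => if τ n ≤ t then v n else 0 := by
    refine summable_of_hasFiniteSupport (hfin.subset fun n hn => ?_)
    by_contra h
    exact hn (if_neg fun h' => h (le_trans h' htT))
  rw [pointSum, ENNReal.ofReal_tsum_of_nonneg (fun n => by split_ifs <;> simp [hv]) hs]
  exact tsum_congr fun n => by split_ifs <;> simp

end Deterministic

/-! ### Grönwall's lemma for bounded functions -/

/-- In the supremum norm weighted by e^{-2B(t-a)}, the integral operator has norm at most 1/2, so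
its contribution is absorbed into the left side. Boundedness by M makes the weighted norm finite; no
measurability of y is needed. -/
lemma gronwall_lintegral {a b : ℝ} {y : ℝ → ℝ≥0∞} {M A : ℝ≥0∞} {B : ℝ} (hB : 0 < B) (hM : M ≠ ∞)
    (hyM : ∀ t ∈ Set.Icc a b, y t ≤ M)
    (hy : ∀ t ∈ Set.Icc a b, y t ≤ A + ENNReal.ofReal B * ∫⁻ s in Set.Icc a t, y s) :
    ∀ t ∈ Set.Icc a b, y t ≤ ENNReal.ofReal (Real.exp (2 * B * (t - a))) * (2 * A) := by
  set E : ℝ → ℝ≥0∞ := fun t => ENNReal.ofReal (Real.exp (2 * B * (t - a))) with hE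
  have hE1 : ∀ t, a ≤ t → 1 ≤ E t := fun t ht => by
    rw [hE, ENNReal.one_le_ofReal]
    exact Real.one_le_exp (by nlinarith)
  have hE0 : ∀ t, E t ≠ 0 := fun t => by simp [hE, Real.exp_pos]
  have hEt : ∀ t, E t ≠ ∞ := fun t => ENNReal.ofReal_ne_top
  set S : ℝ≥0∞ := ⨆ t ∈ Set.Icc a b, y t / E t with hS
  have hSle : ∀ t ∈ Set.Icc a b, y t ≤ E t * S := fun t ht => by
    have : y t / E t ≤ S := le_iSup₂ (f := fun t (_ : t ∈ Set.Icc a b) => y t / E t) t ht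
    rw [mul_comm]
    exact (ENNReal.div_le_iff (hE0 t) (hEt t)).1 this
  have hStop : S ≠ ∞ := by
    refine ne_top_of_le_ne_top hM (iSup₂_le fun t ht => ?_)
    exact ENNReal.div_le_of_le_mul ((hyM t ht).trans (le_mul_of_one_le_right' (hE1 t ht.1)))
  have hint : ∀ t ∈ Set.Icc a b, ENNReal.ofReal B * ∫⁻ s in Set.Icc a t, E s ≤ E t / 2 := by
    intro t ht
    have hd : ∀ x ∈ Set.uIcc a t, HasDerivAt (fun s => Real.exp (2 * B * (s - a)) / (2 * B))
        (Real.exp (2 * B * (x - a))) x := fun x _ => by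
      have := ((((hasDerivAt_id x).sub_const a).const_mul (2 * B)).exp).div_const (2 * B)
      exact this.congr_deriv (by simp only [id]; field_simp)
    have hc : Continuous fun s => Real.exp (2 * B * (s - a)) := by fun_prop
    have hi := intervalIntegral.integral_eq_sub_of_hasDerivAt hd (hc.intervalIntegrable _ _)
    rw [hE, ← ofReal_integral_eq_lintegral_ofReal (hc.integrableOn_Icc)
      (Filter.Eventually.of_forall fun s => (Real.exp_pos _).le), integral_Icc_eq_integral_Ioc,
      ← intervalIntegral.integral_of_le ht.1, hi, ← ENNReal.ofReal_mul hB.le]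
    have h2 : (2 : ℝ≥0∞) = ENNReal.ofReal 2 := by simp
    rw [h2, ← ENNReal.ofReal_div_of_pos (by norm_num)]
    refine ENNReal.ofReal_le_ofReal ?_
    field_simp
    simp
  have hfin : S ≤ A + S / 2 := by
    refine iSup₂_le fun t ht => ?_
    rw [ENNReal.div_le_iff (hE0 t) (hEt t)]
    calc y t ≤ A + ENNReal.ofReal B * ∫⁻ s in Set.Icc a t, y s := hy t ht
      _ ≤ A + ENNReal.ofReal B * ∫⁻ s in Set.Icc a t, E s * S := by
          gcongr 2
          exact setLIntegral_mono' measurableSet_Icc fun s hs =>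
            hSle s ⟨hs.1, hs.2.trans ht.2⟩
      _ = A + (ENNReal.ofReal B * ∫⁻ s in Set.Icc a t, E s) * S := by
          rw [lintegral_mul_const' _ _ hStop, mul_assoc]
      _ ≤ A * E t + (E t / 2) * S := by
          gcongr
          · exact le_mul_of_one_le_right' (hE1 t ht.1)
          · exact hint t ht
      _ = (A + S / 2) * E t := by
          simp only [div_eq_mul_inv]
          ring
  -- Cancelling S / 2 in `ℝ≥0∞` is where finiteness of S is used.
  have hS2 : S ≤ 2 * A := by
    have h1 : S / 2 + S / 2 ≤ A + S / 2 := by rwa [ENNReal.add_halves]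
    have h2 : S / 2 ≤ A :=
      (ENNReal.add_le_add_iff_right (ENNReal.div_ne_top hStop (by simp))).1 h1
    rw [mul_comm]
    exact (ENNReal.div_le_iff (by simp) (by simp)).1 h2
  intro t ht
  exact (hSle t ht).trans (by gcongr)

/-- A bounded solution of a scalar linear integral equation is determined by the equation. -/
lemma eqOn_of_integral_eq {a b A c C : ℝ} {y z g : ℝ → ℝ}
    (hyC : ∀ t ∈ Set.Icc a b, |y t| ≤ C)
    (hyi : IntervalIntegrable y volume a b)
    (hy : ∀ t ∈ Set.Icc a b, y t = c + ∫ s in a..t, (A * y s + g s))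
    (hz : ∀ t, HasDerivAt z (A * z t + g t) t) (hg : Continuous g) (hc : z a = c) :
    ∀ t ∈ Set.Icc a b, y t = z t := by
  have hzc : Continuous z := continuous_iff_continuousAt.2 fun t => (hz t).continuousAt
  obtain ⟨Cz, hCz⟩ := (isCompact_Icc (a := a) (b := b)).exists_bound_of_continuousOn
    hzc.continuousOn
  have hd : ∀ t ∈ Set.Icc a b, y t - z t = ∫ s in a..t, A * (y s - z s) := fun t ht => by
    have hyt : IntervalIntegrable y volume a t :=
      hyi.mono_set (Set.uIcc_subset_uIcc_left (by
        rw [Set.uIcc_of_le (ht.1.trans ht.2)]; exact ht))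
    have h1 := intervalIntegral.integral_eq_sub_of_hasDerivAt (a := a) (b := t) (fun x _ => hz x)
      (((hzc.const_mul A).add hg).intervalIntegrable _ _)
    have h2 := intervalIntegral.integral_sub ((hyt.const_mul A).add (hg.intervalIntegrable _ _))
      (((hzc.const_mul A).add hg).intervalIntegrable a t)
    simp only [Pi.add_apply] at h2
    rw [h1] at h2
    have h3 : y t - z t = (∫ s in a..t, (A * y s + g s)) - (z t - z a) := by
      rw [hy t ht, hc]; ring
    rw [h3, ← h2]
    exact intervalIntegral.integral_congr fun s _ => by ring
  -- The difference satisfies the homogeneous inequality, so A = 0 and the bound is zero; |A| + 1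
  -- keeps the constant positive when the coefficient vanishes.
  have key := gronwall_lintegral (a := a) (b := b) (y := fun t => ‖y t - z t‖ₑ)
    (M := ENNReal.ofReal (C + Cz)) (A := 0) (B := |A| + 1) (by positivity) ENNReal.ofReal_ne_top
    (fun t ht => by
      rw [← ofReal_norm]
      refine ENNReal.ofReal_le_ofReal ((norm_sub_le _ _).trans ?_)
      exact add_le_add (hyC t ht) (hCz t ht))
    (fun t ht => by
      rw [hd t ht, zero_add, intervalIntegral.integral_of_le ht.1, ← integral_Icc_eq_integral_Ioc]
      refine (enorm_integral_le_lintegral_enorm _).trans ?_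
      rw [← lintegral_const_mul' _ _ ENNReal.ofReal_ne_top]
      refine lintegral_mono fun s => ?_
      rw [enorm_mul]
      gcongr
      rw [← ofReal_norm]
      exact ENNReal.ofReal_le_ofReal (by simp))
  intro t ht
  have := key t ht
  simpa [sub_eq_zero] using this

/-! ### Predictability of left sums -/

section Predictable

variable {Ω : Type*} {mΩ : MeasurableSpace Ω} {ℱ : Filtration ℝ≥0 mΩ}

/-- If ρ < t, a point q of a countable dense set lies strictly between. The set is thus a countable
union of rectangles (q, ∞) × (A ∩ {ρ ≤ q}), and A ∩ {ρ ≤ q} is known at time q. -/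
lemma measurableSet_predictable_lt_inter {ρ : Ω → ℝ≥0}
    (hρ : IsStoppingTime ℱ fun ω => ((ρ ω : ℝ≥0) : WithTop ℝ≥0)) {A : Set Ω}
    (hA : MeasurableSet[hρ.measurableSpace] A) :
    MeasurableSet[ℱ.predictable] {p : ℝ≥0 × Ω | ρ p.2 < p.1 ∧ p.2 ∈ A} := by
  obtain ⟨D, hDc, hD⟩ := TopologicalSpace.exists_countable_dense ℝ≥0
  have : {p : ℝ≥0 × Ω | ρ p.2 < p.1 ∧ p.2 ∈ A} =
      ⋃ q ∈ D, Set.Ioi q ×ˢ (A ∩ {ω | ((ρ ω : ℝ≥0) : WithTop ℝ≥0) ≤ q}) := by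
    ext ⟨t, ω⟩
    simp only [Set.mem_ofPred_eq, Set.mem_iUnion, Set.mem_prod, Set.mem_Ioi, Set.mem_inter_iff,
      WithTop.coe_le_coe, exists_prop]
    constructor
    · rintro ⟨h, hω⟩
      obtain ⟨q, hq, h1, h2⟩ := hD.exists_between h
      exact ⟨q, hq, h2, hω, h1.le⟩
    · rintro ⟨q, _, h2, hω, h1⟩
      exact ⟨h1.trans_lt h2, hω⟩
  rw [this]
  exact MeasurableSet.biUnion hDc fun q _ => measurableSet_predictable_Ioi_prod (hA.2 q)

lemma measurableSet_predictable_lt {ρ : Ω → ℝ≥0}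
    (hρ : IsStoppingTime ℱ fun ω => ((ρ ω : ℝ≥0) : WithTop ℝ≥0)) :
    MeasurableSet[ℱ.predictable] {p : ℝ≥0 × Ω | ρ p.2 < p.1} := by
  simpa using measurableSet_predictable_lt_inter hρ MeasurableSet.univ

lemma measurable_predictable_ite_lt {ρ : Ω → ℝ≥0}
    (hρ : IsStoppingTime ℱ fun ω => ((ρ ω : ℝ≥0) : WithTop ℝ≥0)) {v : Ω → ℝ}
    (hv : Measurable[hρ.measurableSpace] v) :
    Measurable[ℱ.predictable] fun p : ℝ≥0 × Ω => if (ρ p.2 : ℝ) < p.1 then v p.2 else 0 := by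
  intro B hB
  have h1 := measurableSet_predictable_lt_inter hρ (hv hB)
  have h2 := (measurableSet_predictable_lt hρ).compl
  -- The default value 0 is taken off {ρ < t}, so that complement joins the preimage exactly when 0
  -- ∈ B.
  by_cases h0 : (0 : ℝ) ∈ B
  · convert h1.union h2 using 1
    ext p
    by_cases hp : ρ p.2 < p.1 <;> simp [hp, h0]
  · convert h1 using 1
    ext p
    by_cases hp : ρ p.2 < p.1 <;> simp [hp, h0]

lemma measurable_predictable_leftSum {τ : ℕ → Ω → ℝ≥0}
    (hτ : ∀ n, IsStoppingTime ℱ fun ω => ((τ n ω : ℝ≥0) : WithTop ℝ≥0)) {v : ℕ → Ω → ℝ}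
    (hv : ∀ n, Measurable[(hτ n).measurableSpace] (v n)) :
    Measurable[ℱ.predictable]
      fun p : ℝ≥0 × Ω => leftSum (fun n => (τ n p.2 : ℝ)) (fun n => v n p.2) p.1 := by
  let : MeasurableSpace (ℝ≥0 × Ω) := ℱ.predictable
  exact Measurable.tsum fun n => measurable_predictable_ite_lt (hτ n) (hv n)

lemma measurable_predictable_fst : Measurable[ℱ.predictable] (Prod.fst : ℝ≥0 × Ω → ℝ≥0) := by
  let : MeasurableSpace (ℝ≥0 × Ω) := ℱ.predictable
  refine measurable_of_Ioi fun t => ?_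
  convert measurableSet_predictable_Ioi_prod (𝓕 := ℱ) (i := t) (s := Set.univ) MeasurableSet.univ
    using 1
  ext p
  simp

end Predictable

/-! ### Weighted sums over the arrivals: measurability and the compensator formula -/

/-- The weight `c(εₙ) ξₙ h(τₙ)` of the `n`-th arrival. -/
def weight {Ω : Type*} (τ : ℕ → Ω → ℝ≥0) (ε : ℕ → Ω → Fin 2) (ξ : ℕ → Ω → ℝ) (c : Fin 2 → ℝ)
    (h : ℝ → ℝ) (ω : Ω) (n : ℕ) : ℝ :=
  c (ε n ω) * (ξ n ω * h (τ n ω))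

/-- The sum of the weights `c(εₙ) ξₙ h(τₙ)` over the arrivals up to time `t`. -/
def markSum {Ω : Type*} (τ : ℕ → Ω → ℝ≥0) (ε : ℕ → Ω → Fin 2) (ξ : ℕ → Ω → ℝ) (c : Fin 2 → ℝ)
    (h : ℝ → ℝ) (t : ℝ) (ω : Ω) : ℝ :=
  pointSum (fun n => (τ n ω : ℝ)) (weight τ ε ξ c h ω) t

lemma measurable_weight_of {Ω : Type*} {mΩ : MeasurableSpace Ω} {τ : ℕ → Ω → ℝ≥0}
    {ε : ℕ → Ω → Fin 2} {ξ : ℕ → Ω → ℝ} (c : Fin 2 → ℝ) {h : ℝ → ℝ} (hh : Measurable h) {n : ℕ}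
    (hτ : Measurable fun ω => (τ n ω : ℝ)) (hε : Measurable (ε n)) (hξ : Measurable (ξ n)) :
    Measurable fun ω => weight τ ε ξ c h ω n :=
  ((measurable_of_finite c).comp hε).mul (hξ.mul (hh.comp hτ))

namespace IsMarkedHawkes

variable {Ω : Type*} [mΩ : MeasurableSpace Ω] {P : Measure Ω}
  {ℱ : Filtration ℝ≥0 mΩ} {T : ℝ} {μ : ℝ → ℝ} {φ : ℝ → Matrix (Fin 2) (Fin 2) ℝ}
  {τ : ℕ → Ω → ℝ≥0} {ε : ℕ → Ω → Fin 2} {ξ : ℕ → Ω → ℝ} {J : Ω → ℝ}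

lemma strictMono (hN : IsMarkedHawkes P ℱ T μ φ τ ε ξ J) (ω : Ω) :
    StrictMono fun n => (τ n ω : ℝ) :=
  fun _ _ h => NNReal.coe_lt_coe.2 (hN.tau_strictMono ω h)

lemma measurable_tau' (hN : IsMarkedHawkes P ℱ T μ φ τ ε ξ J) (n : ℕ) :
    Measurable[(hN.isStoppingTime n).measurableSpace] fun ω => (τ n ω : ℝ) := by
  refine measurable_of_Iic fun x => ?_
  rcases lt_or_ge x 0 with hx | hx
  · convert MeasurableSet.empty
    ext ω
    simpa using hx.trans_le (τ n ω).2
  · convert (hN.isStoppingTime n).measurableSet_le' x.toNNReal using 1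
    ext ω
    change (τ n ω : ℝ) ≤ x ↔ ((τ n ω : ℝ≥0) : WithTop ℝ≥0) ≤ (x.toNNReal : ℝ≥0)
    rw [WithTop.coe_le_coe, ← NNReal.coe_le_coe, Real.coe_toNNReal _ hx]

lemma measurable_tau (hN : IsMarkedHawkes P ℱ T μ φ τ ε ξ J) (n : ℕ) :
    Measurable fun ω => (τ n ω : ℝ) :=
  (hN.measurable_tau' n).mono (hN.isStoppingTime n).measurableSpace_le le_rfl

lemma measurable_mark (hN : IsMarkedHawkes P ℱ T μ φ τ ε ξ J) (n : ℕ) : Measurable (ξ n) :=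
  (hN.mark_measurable n).mono (hN.isStoppingTime n).measurableSpace_le le_rfl

lemma measurable_type (hN : IsMarkedHawkes P ℱ T μ φ τ ε ξ J) (n : ℕ) : Measurable (ε n) :=
  (hN.type_measurable n).mono (hN.isStoppingTime n).measurableSpace_le le_rfl

lemma measurable_weight' (hN : IsMarkedHawkes P ℱ T μ φ τ ε ξ J) (c : Fin 2 → ℝ) {h : ℝ → ℝ}
    (hh : Measurable h) (n : ℕ) :
    Measurable[(hN.isStoppingTime n).measurableSpace] fun ω => weight τ ε ξ c h ω n := by
  exact measurable_weight_of c hh (hN.measurable_tau' n) (hN.type_measurable n)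
    (hN.mark_measurable n)

lemma measurable_weight (hN : IsMarkedHawkes P ℱ T μ φ τ ε ξ J) (c : Fin 2 → ℝ) {h : ℝ → ℝ}
    (hh : Measurable h) (n : ℕ) : Measurable fun ω => weight τ ε ξ c h ω n :=
  (hN.measurable_weight' c hh n).mono (hN.isStoppingTime n).measurableSpace_le le_rfl

lemma measurable_pointSum (hN : IsMarkedHawkes P ℱ T μ φ τ ε ξ J) {v : Ω → ℕ → ℝ}
    (hv : ∀ n, Measurable fun ω => v ω n) :
    Measurable fun p : ℝ × Ω => pointSum (fun n => (τ n p.2 : ℝ)) (v p.2) p.1 :=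
  Measurable.tsum fun n => Measurable.ite
    (measurableSet_le ((hN.measurable_tau n).comp measurable_snd) measurable_fst)
    ((hv n).comp measurable_snd) measurable_const

lemma measurable_leftSum (hN : IsMarkedHawkes P ℱ T μ φ τ ε ξ J) {v : Ω → ℕ → ℝ}
    (hv : ∀ n, Measurable fun ω => v ω n) :
    Measurable fun p : ℝ × Ω => leftSum (fun n => (τ n p.2 : ℝ)) (v p.2) p.1 :=
  Measurable.tsum fun n => Measurable.ite
    (measurableSet_lt ((hN.measurable_tau n).comp measurable_snd) measurable_fst)
    ((hv n).comp measurable_snd) measurable_const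

lemma measurable_markSum (hN : IsMarkedHawkes P ℱ T μ φ τ ε ξ J) (c : Fin 2 → ℝ) {h : ℝ → ℝ}
    (hh : Measurable h) : Measurable fun p : ℝ × Ω => markSum τ ε ξ c h p.1 p.2 :=
  hN.measurable_pointSum (hN.measurable_weight c hh)

lemma identDistrib_mark_zero (hN : IsMarkedHawkes P ℱ T μ φ τ ε ξ J) : P.map J = P.map (ξ 0) :=
  (hN.mark_identDistrib 0).map_eq.symm

open Classical in
/-- The compensator formula for an integrand that factorizes into a predictable process and a
function of the mark. -/
lemma lintegral_tsum_eq (hN : IsMarkedHawkes P ℱ T μ φ τ ε ξ J) (i : Fin 2)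
    {Z : ℝ≥0 × Ω → ℝ≥0∞} (hZ : Measurable[ℱ.predictable] Z) {g : ℝ → ℝ≥0∞} (hg : Measurable g)
    (hG : ∫⁻ ω, g (ξ 0 ω) ∂P ≠ ∞) {t : ℝ} (htT : t ≤ T) :
    ∫⁻ ω, (∑' n, if (τ n ω : ℝ) ≤ t ∧ ε n ω = i then Z (τ n ω, ω) * g (ξ n ω) else 0) ∂P =
      (∫⁻ ω, g (ξ 0 ω) ∂P) * ∫⁻ ω, (∫⁻ s in Set.Icc (0 : ℝ) t, Z (s.toNNReal, ω) *
        ENNReal.ofReal (intensity T μ φ τ ε ξ i s ω)) ∂P := by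
  -- The factor 1_{s ≤ t} is predictable and reduces the formula on [0, t] to the one on [0, T].
  have hW : Measurable[ℱ.predictable.prod (borel ℝ)] fun q : (ℝ≥0 × Ω) × ℝ =>
      (if (q.1.1 : ℝ) ≤ t then Z q.1 else 0) * g q.2 := by
    let : MeasurableSpace (ℝ≥0 × Ω) := ℱ.predictable
    rw [← BorelSpace.measurable_eq (α := ℝ)]
    have h1 : Measurable fun p : ℝ≥0 × Ω => (p.1 : ℝ) :=
      measurable_coe_nnreal_real.comp measurable_predictable_fst
    have h2 : Measurable fun p : ℝ≥0 × Ω => if (p.1 : ℝ) ≤ t then Z p else 0 :=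
      Measurable.ite (h1 measurableSet_Iic) hZ measurable_const
    exact (h2.comp measurable_fst).mul (hg.comp measurable_snd)
  have hcomp := hN.compensator i _ hW
  have hl : ∀ ω n, (if (τ n ω : ℝ) ≤ t ∧ ε n ω = i then Z (τ n ω, ω) * g (ξ n ω) else 0) =
      if (τ n ω : ℝ) ≤ T ∧ ε n ω = i then
        (if (τ n ω : ℝ) ≤ t then Z (τ n ω, ω) else 0) * g (ξ n ω) else 0 := fun ω n => by
    by_cases h1 : (τ n ω : ℝ) ≤ t
    · simp [h1, h1.trans htT]
    · simp [h1]
  simp only [hl]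
  refine hcomp.trans ?_
  have hJ : ∀ z : ℝ≥0∞, ∫⁻ x, z * g x ∂(P.map J) = (∫⁻ ω, g (ξ 0 ω) ∂P) * z := fun z => by
    rw [lintegral_const_mul _ hg, hN.identDistrib_mark_zero,
      lintegral_map hg (hN.measurable_mark 0), mul_comm]
  rw [← lintegral_const_mul' _ _ hG]
  refine lintegral_congr fun ω => ?_
  rw [← lintegral_const_mul' _ _ hG]
  simp only [hJ]
  rw [← lintegral_indicator measurableSet_Icc, ← lintegral_indicator measurableSet_Icc]
  refine lintegral_congr fun s => ?_
  by_cases hs : 0 ≤ s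
  · by_cases hst : s ≤ t
    · simp [hs, hst, hst.trans htT, hs.trans hst, mul_assoc]
    · simp [hs, hst]
  · simp [hs]

end IsMarkedHawkes

/-! ### The intensity -/

section Intensity

variable {Ω : Type*} {T μ₀ κ α β : ℝ} {τ : ℕ → Ω → ℝ≥0} {ε : ℕ → Ω → Fin 2} {ξ : ℕ → Ω → ℝ}

lemma markIntegral_eq_markSum (j : Fin 2) (h : ℝ → ℝ) (t : ℝ) (ω : Ω) :
    markIntegral τ ε ξ j h t ω = markSum τ ε ξ (Pi.single j 1) h t ω := by
  refine tsum_congr fun n => ?_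
  by_cases h1 : (τ n ω : ℝ) ≤ t <;> by_cases h2 : ε n ω = j <;>
    simp [h1, h2, weight]

lemma markIntegral_exp_sub (j : Fin 2) (t : ℝ) (ω : Ω) :
    markIntegral τ ε ξ j (fun s => α * Real.exp (-β * (t - s))) t ω =
      α * (Real.exp (-β * t) *
        markSum τ ε ξ (Pi.single j 1) (fun s => Real.exp (β * s)) t ω) := by
  rw [markIntegral_eq_markSum, markSum, markSum, pointSum, pointSum, ← tsum_mul_left,
    ← tsum_mul_left]
  refine tsum_congr fun n => ?_
  have : Real.exp (-β * (t - τ n ω)) = Real.exp (-β * t) * Real.exp (β * τ n ω) := by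
    rw [← Real.exp_add]; ring_nf
  simp only [weight, this]
  split_ifs <;> ring

lemma intensity_zero_eq (t : ℝ) (ω : Ω) :
    intensity T (expBaseline μ₀ κ) (expKernel α β) τ ε ξ 0 t ω =
      μ₀ * Real.exp (κ * (t / T)) + α * (Real.exp (-β * t) *
        markSum τ ε ξ (Pi.single 1 1) (fun s => Real.exp (β * s)) t ω) := by
  rw [intensity, Fin.sum_univ_two, ← markIntegral_exp_sub]
  simp [expBaseline, expKernel, markIntegral]

lemma intensity_one_eq (t : ℝ) (ω : Ω) :
    intensity T (expBaseline μ₀ κ) (expKernel α β) τ ε ξ 1 t ω =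
      μ₀ * Real.exp (κ * (t / T)) + α * (Real.exp (-β * t) *
        markSum τ ε ξ (Pi.single 0 1) (fun s => Real.exp (β * s)) t ω) := by
  rw [intensity, Fin.sum_univ_two, ← markIntegral_exp_sub]
  simp [expBaseline, expKernel, markIntegral]

lemma intensity_eq (i : Fin 2) : ∃ j : Fin 2, ∀ (t : ℝ) (ω : Ω),
    intensity T (expBaseline μ₀ κ) (expKernel α β) τ ε ξ i t ω =
      μ₀ * Real.exp (κ * (t / T)) + α * (Real.exp (-β * t) *
        markSum τ ε ξ (Pi.single j 1) (fun s => Real.exp (β * s)) t ω) := by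
  fin_cases i
  · exact ⟨1, intensity_zero_eq⟩
  · exact ⟨0, intensity_one_eq⟩

end Intensity

namespace IsMarkedHawkes

variable {Ω : Type*} [mΩ : MeasurableSpace Ω] {P : Measure Ω}
  {ℱ : Filtration ℝ≥0 mΩ} {T μ₀ κ α β : ℝ}
  {τ : ℕ → Ω → ℝ≥0} {ε : ℕ → Ω → Fin 2} {ξ : ℕ → Ω → ℝ} {J : Ω → ℝ}

lemma measurable_intensity
    (hN : IsMarkedHawkes P ℱ T (expBaseline μ₀ κ) (expKernel α β) τ ε ξ J) (i : Fin 2) :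
    Measurable fun p : ℝ × Ω =>
      intensity T (expBaseline μ₀ κ) (expKernel α β) τ ε ξ i p.1 p.2 := by
  obtain ⟨j, hj⟩ := intensity_eq (Ω := Ω) (T := T) (μ₀ := μ₀) (κ := κ) (α := α) (β := β)
    (τ := τ) (ε := ε) (ξ := ξ) i
  simp only [hj]
  have := hN.measurable_markSum (Pi.single j 1) (h := fun s => Real.exp (β * s)) (by fun_prop)
  fun_prop

lemma weight_single_nonneg
    (hN : IsMarkedHawkes P ℱ T (expBaseline μ₀ κ) (expKernel α β) τ ε ξ J) (j : Fin 2) (ω : Ω)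
    (n : ℕ) : 0 ≤ weight τ ε ξ (Pi.single j 1) (fun s => Real.exp (β * s)) ω n := by
  refine mul_nonneg ?_ (mul_nonneg (hN.mark_pos n ω).le (Real.exp_pos _).le)
  rw [Pi.single_apply]
  split_ifs <;> norm_num

lemma intensity_nonneg
    (hN : IsMarkedHawkes P ℱ T (expBaseline μ₀ κ) (expKernel α β) τ ε ξ J) (hμ₀ : 0 < μ₀)
    (hα : 0 < α) (i : Fin 2) (t : ℝ) (ω : Ω) :
    0 ≤ intensity T (expBaseline μ₀ κ) (expKernel α β) τ ε ξ i t ω := by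
  obtain ⟨j, hj⟩ := intensity_eq (Ω := Ω) (T := T) (μ₀ := μ₀) (κ := κ) (α := α) (β := β)
    (τ := τ) (ε := ε) (ξ := ξ) i
  have : 0 ≤ markSum τ ε ξ (Pi.single j 1) (fun s => Real.exp (β * s)) t ω :=
    pointSum_nonneg (hN.weight_single_nonneg j ω)
  rw [hj]
  positivity

/-- The intensity is bounded by any sum over the points that dominates the marks. -/
lemma intensity_le
    (hN : IsMarkedHawkes P ℱ T (expBaseline μ₀ κ) (expKernel α β) τ ε ξ J) (hT : 0 < T)
    (hμ₀ : 0 < μ₀) (hκ : 0 < κ) (hα : 0 < α) (hβ : 0 < β) (i : Fin 2) {t : ℝ} (htT : t ≤ T) (ω : Ω)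
    {v : ℕ → ℝ} (hv : ∀ n, (τ n ω : ℝ) ≤ t → ξ n ω ≤ v n) :
    intensity T (expBaseline μ₀ κ) (expKernel α β) τ ε ξ i t ω ≤
      μ₀ * Real.exp κ + α * pointSum (fun n => (τ n ω : ℝ)) v t := by
  obtain ⟨j, hj⟩ := intensity_eq (Ω := Ω) (T := T) (μ₀ := μ₀) (κ := κ) (α := α) (β := β)
    (τ := τ) (ε := ε) (ξ := ξ) i
  rw [hj]
  have h1 : κ * (t / T) ≤ κ := mul_le_of_le_one_right hκ.le ((div_le_one hT).2 htT)
  gcongr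
  obtain ⟨K, hK⟩ := exists_forall_pointSum_eq (hN.strictMono ω) (hN.locallyFinite ω) htT
  rw [markSum, hK, hK, Finset.mul_sum]
  refine Finset.sum_le_sum fun n _ => ?_
  split_ifs with h
  · refine le_trans ?_ (hv n h)
    have h2 : Real.exp (-β * t) * weight τ ε ξ (Pi.single j 1) (fun s => Real.exp (β * s)) ω n =
        (Pi.single j 1 : Fin 2 → ℝ) (ε n ω) * (ξ n ω * Real.exp (-(β * (t - τ n ω)))) := by
      have : Real.exp (-(β * (t - τ n ω))) = Real.exp (-β * t) * Real.exp (β * τ n ω) := by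
        rw [← Real.exp_add]; ring_nf
      rw [this, weight]; ring
    rw [h2]
    have h3 : Real.exp (-(β * (t - τ n ω))) ≤ 1 :=
      Real.exp_le_one_iff.2 (by have := mul_nonneg hβ.le (sub_nonneg.2 h); linarith)
    have h4 := hN.mark_pos n ω
    rw [Pi.single_apply]
    split_ifs
    · rw [one_mul]
      exact mul_le_of_le_one_right h4.le h3
    · rw [zero_mul]
      exact h4.le
  · simp

/-! ### The marks -/

lemma memLp_mark {μ : ℝ → ℝ} {φ : ℝ → Matrix (Fin 2) (Fin 2) ℝ}
    (hN : IsMarkedHawkes P ℱ T μ φ τ ε ξ J) (n : ℕ) : MemLp (ξ n) 2 P :=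
  (hN.mark_identDistrib n).memLp_iff.2 hN.memLp_two

lemma lintegral_mark {μ : ℝ → ℝ} {φ : ℝ → Matrix (Fin 2) (Fin 2) ℝ} [IsProbabilityMeasure P]
    (hN : IsMarkedHawkes P ℱ T μ φ τ ε ξ J) :
    ∫⁻ ω, ENNReal.ofReal (ξ 0 ω) ∂P = ENNReal.ofReal (∫ ω, J ω ∂P) := by
  rw [← (hN.mark_identDistrib 0).integral_eq, ofReal_integral_eq_lintegral_ofReal
    ((hN.memLp_mark 0).integrable (by norm_num))
    (Filter.Eventually.of_forall fun ω => (hN.mark_pos 0 ω).le)]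

lemma lintegral_mark_sq {μ : ℝ → ℝ} {φ : ℝ → Matrix (Fin 2) (Fin 2) ℝ}
    (hN : IsMarkedHawkes P ℱ T μ φ τ ε ξ J) :
    ∫⁻ ω, ENNReal.ofReal (ξ 0 ω ^ 2) ∂P = ENNReal.ofReal (∫ ω, J ω ^ 2 ∂P) := by
  have h : ∫ ω, ξ 0 ω ^ 2 ∂P = ∫ ω, J ω ^ 2 ∂P :=
    ((hN.mark_identDistrib 0).comp (u := fun x => x ^ 2) (by fun_prop)).integral_eq
  rw [← h, ofReal_integral_eq_lintegral_ofReal (hN.memLp_mark 0).integrable_sq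
    (Filter.Eventually.of_forall fun ω => sq_nonneg _)]

lemma integral_mark_nonneg {μ : ℝ → ℝ} {φ : ℝ → Matrix (Fin 2) (Fin 2) ℝ}
    (hN : IsMarkedHawkes P ℱ T μ φ τ ε ξ J) : 0 ≤ ∫ ω, J ω ∂P := by
  rw [← (hN.mark_identDistrib 0).integral_eq]
  exact integral_nonneg fun ω => (hN.mark_pos 0 ω).le

/-! ### Square integrability of the total mark -/

/-- Marks of the arrivals up to the `N`-th one. -/
def truncMark (ξ : ℕ → Ω → ℝ) (N : ℕ) (ω : Ω) (n : ℕ) : ℝ := if n ≤ N then ξ n ω else 0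

lemma truncMark_nonneg (hN : IsMarkedHawkes P ℱ T (expBaseline μ₀ κ) (expKernel α β) τ ε ξ J)
    (N : ℕ) (ω : Ω) (n : ℕ) : 0 ≤ truncMark ξ N ω n := by
  rw [truncMark]; split_ifs; exacts [(hN.mark_pos n ω).le, le_rfl]

lemma measurable_truncMark (hN : IsMarkedHawkes P ℱ T (expBaseline μ₀ κ) (expKernel α β) τ ε ξ J)
    (N n : ℕ) : Measurable fun ω => truncMark ξ N ω n := by
  unfold truncMark
  split_ifs
  exacts [hN.measurable_mark n, measurable_const]

lemma measurable_truncMark' (hN : IsMarkedHawkes P ℱ T (expBaseline μ₀ κ) (expKernel α β) τ ε ξ J)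
    (N n : ℕ) :
    Measurable[(hN.isStoppingTime n).measurableSpace] fun ω => truncMark ξ N ω n := by
  unfold truncMark
  split_ifs
  exacts [hN.mark_measurable n, measurable_const]

/-- Integration by parts writes the square of the truncated sum ℓ as a sum of 2ℓ₋ξ + ξ² over the
first arrivals, and the compensator turns it into a time integral. Up to the last retained arrival ℓ
contains all marks so far, so the intensity is at most affine in ℓ and the integrand at most
quadratic. The constant does not depend on the truncation. -/
lemma lintegral_truncMark_sq_le [IsProbabilityMeasure P]
    (hN : IsMarkedHawkes P ℱ T (expBaseline μ₀ κ) (expKernel α β) τ ε ξ J) (hT : 0 < T)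
    (hμ₀ : 0 < μ₀) (hκ : 0 < κ) (hα : 0 < α) (hβ : 0 < β) :
    ∃ C : ℝ, 0 < C ∧ ∀ (N : ℕ), ∀ t ∈ Set.Icc 0 T,
      ∫⁻ ω, ENNReal.ofReal (pointSum (fun n => (τ n ω : ℝ)) (truncMark ξ N ω) t ^ 2) ∂P ≤
        ENNReal.ofReal (C * T) + ENNReal.ofReal C * ∫⁻ s in Set.Icc 0 t,
          ∫⁻ ω, ENNReal.ofReal (pointSum (fun n => (τ n ω : ℝ)) (truncMark ξ N ω) s ^ 2) ∂P := by
  classical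
  set m : ℝ := ∫ ω, J ω ∂P with hm
  set m₂ : ℝ := ∫ ω, J ω ^ 2 ∂P with hm₂
  have hm0 : 0 ≤ m := hN.integral_mark_nonneg
  have hm20 : 0 ≤ m₂ := integral_nonneg fun ω => sq_nonneg _
  -- A bound for (2mℓ + m₂)λ: the first two factors are the prefactors of 1 + ℓ, and the last 2
  -- comes from (1 + ℓ)² ≤ 2(1 + ℓ²).
  set D : ℝ := (2 * m + m₂) * (μ₀ * Real.exp κ + α) * 2 with hD
  have hD0 : 0 ≤ D := by positivity
  -- One D for each of the two types; the 1 makes the constant positive.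
  refine ⟨2 * D + 1, by positivity, fun N t ht => ?_⟩
  set lam : Fin 2 → ℝ → Ω → ℝ :=
    fun i => intensity T (expBaseline μ₀ κ) (expKernel α β) τ ε ξ i with hlam
  set ℓ : ℝ → Ω → ℝ := fun s ω => pointSum (fun n => (τ n ω : ℝ)) (truncMark ξ N ω) s with hℓ
  set p : ℝ → Ω → ℝ := fun s ω => leftSum (fun n => (τ n ω : ℝ)) (truncMark ξ N ω) s with hp
  -- Both integrands vanish strictly after the N-th arrival, which is the predictable form of the
  -- truncation n ≤ N.
  set Z₁ : ℝ≥0 × Ω → ℝ≥0∞ :=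
    fun q => if τ N q.2 < q.1 then 0 else ENNReal.ofReal (2 * p q.1 q.2) with hZ₁
  set Z₂ : ℝ≥0 × Ω → ℝ≥0∞ := fun q => if τ N q.2 < q.1 then 0 else 1 with hZ₂
  have hZ₁m : Measurable[ℱ.predictable] Z₁ := by
    have hl := measurable_predictable_leftSum hN.isStoppingTime (v := fun n ω => truncMark ξ N ω n)
      (hN.measurable_truncMark' N)
    let : MeasurableSpace (ℝ≥0 × Ω) := ℱ.predictable
    exact Measurable.ite (measurableSet_predictable_lt (hN.isStoppingTime N)) measurable_const
      (hl.const_mul 2).ennreal_ofReal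
  have hZ₂m : Measurable[ℱ.predictable] Z₂ := by
    let : MeasurableSpace (ℝ≥0 × Ω) := ℱ.predictable
    exact Measurable.ite (measurableSet_predictable_lt (hN.isStoppingTime N)) measurable_const
      measurable_const
  have h1 := fun i => hN.lintegral_tsum_eq i hZ₁m (g := fun x => ENNReal.ofReal x)
    (by fun_prop) (by rw [hN.lintegral_mark]; exact ENNReal.ofReal_ne_top) ht.2
  have h2 := fun i => hN.lintegral_tsum_eq i hZ₂m (g := fun x => ENNReal.ofReal (x ^ 2))
    (by fun_prop) (by rw [hN.lintegral_mark_sq]; exact ENNReal.ofReal_ne_top) ht.2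
  have hℓ0 : ∀ s ω, 0 ≤ ℓ s ω := fun s ω => pointSum_nonneg (hN.truncMark_nonneg N ω)
  have hp0 : ∀ s ω, 0 ≤ p s ω := fun s ω => leftSum_nonneg (hN.truncMark_nonneg N ω)
  -- the square as a sum over the points
  have hsq : ∀ ω, ENNReal.ofReal (ℓ t ω ^ 2) = ∑ i : Fin 2,
      ((∑' n, if (τ n ω : ℝ) ≤ t ∧ ε n ω = i then
          Z₁ (τ n ω, ω) * ENNReal.ofReal (ξ n ω) else 0) +
        ∑' n, if (τ n ω : ℝ) ≤ t ∧ ε n ω = i then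
          Z₂ (τ n ω, ω) * ENNReal.ofReal (ξ n ω ^ 2) else 0) := by
    intro ω
    rw [sq, pointSum_mul_pointSum (hN.strictMono ω) (hN.locallyFinite ω) ht.2,
      ofReal_pointSum (hN.locallyFinite ω) ht.2]
    · simp only [← ENNReal.tsum_add]
      rw [← Summable.tsum_finsetSum fun i _ => ENNReal.summable]
      refine tsum_congr fun n => ?_
      have hlt : τ N ω < τ n ω ↔ ¬ n ≤ N := by
        rw [(hN.tau_strictMono ω).lt_iff_lt, not_le]
      have hξ := (hN.mark_pos n ω).le
      have hpn := hp0 (τ n ω) ω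
      have hval : ENNReal.ofReal
          (leftSum (fun n => (τ n ω : ℝ)) (truncMark ξ N ω) (τ n ω) * truncMark ξ N ω n +
            leftSum (fun n => (τ n ω : ℝ)) (truncMark ξ N ω) (τ n ω) * truncMark ξ N ω n +
            truncMark ξ N ω n * truncMark ξ N ω n) =
          Z₁ (τ n ω, ω) * ENNReal.ofReal (ξ n ω) + Z₂ (τ n ω, ω) * ENNReal.ofReal (ξ n ω ^ 2) := by
        by_cases hn : n ≤ N
        · simp only [hZ₁, hZ₂, hlt, hn, truncMark, not_true, if_true, if_false]
          rw [← ENNReal.ofReal_mul (by positivity), one_mul,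
            ← ENNReal.ofReal_add (by positivity) (by positivity)]
          congr 1
          change p _ _ * _ + p _ _ * _ + _ = _
          ring
        · simp [hZ₁, hZ₂, hlt, hn, truncMark]
      rw [hval]
      by_cases htn : (τ n ω : ℝ) ≤ t
      · generalize Z₁ (τ n ω, ω) * ENNReal.ofReal (ξ n ω) = x
        generalize Z₂ (τ n ω, ω) * ENNReal.ofReal (ξ n ω ^ 2) = y
        generalize ε n ω = k
        fin_cases k <;> simp [htn]
      · simp [htn]
    · intro n
      have := hN.truncMark_nonneg N ω n
      have := hp0 (τ n ω) ω
      positivity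
  -- the pointwise bound on the compensator
  have hbound : ∀ i ω, ∀ s ∈ Set.Icc 0 t,
      (ENNReal.ofReal m * (Z₁ (s.toNNReal, ω) * ENNReal.ofReal (lam i s ω)) +
        ENNReal.ofReal m₂ * (Z₂ (s.toNNReal, ω) * ENNReal.ofReal (lam i s ω))) ≤
      ENNReal.ofReal D + ENNReal.ofReal D * ENNReal.ofReal (ℓ s ω ^ 2) := by
    intro i ω s hs
    by_cases hlt : τ N ω < s.toNNReal
    · simp [hZ₁, hZ₂, hlt]
    have hτs : s ≤ τ N ω := by
      rw [not_lt, Real.toNNReal_le_iff_le_coe] at hlt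
      exact hlt
    have hle : lam i s ω ≤ μ₀ * Real.exp κ + α * ℓ s ω := by
      refine hN.intensity_le hT hμ₀ hκ hα hβ i (hs.2.trans ht.2) ω fun n hn => ?_
      have : n ≤ N := (hN.strictMono ω).le_iff_le.1 (hn.trans hτs)
      simp [truncMark, this]
    have hpl : p s ω ≤ ℓ s ω := leftSum_le_pointSum (hN.strictMono ω) (hN.locallyFinite ω)
      (hs.2.trans ht.2) (hN.truncMark_nonneg N ω)
    have hlam0 : 0 ≤ lam i s ω := hN.intensity_nonneg hμ₀ hα i s ω
    have hps := hp0 s ω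
    have hls := hℓ0 s ω
    simp only [hZ₁, hZ₂, hlt, if_false, one_mul, Real.coe_toNNReal _ hs.1]
    rw [← ENNReal.ofReal_mul (by positivity), ← ENNReal.ofReal_mul hm0,
      ← ENNReal.ofReal_mul hm20, ← ENNReal.ofReal_mul hD0,
      ← ENNReal.ofReal_add (by positivity) (by positivity),
      ← ENNReal.ofReal_add hD0 (by positivity)]
    refine ENNReal.ofReal_le_ofReal ?_
    have hE := Real.exp_pos κ
    calc m * (2 * p s ω * lam i s ω) + m₂ * lam i s ω
        = (2 * m * p s ω + m₂) * lam i s ω := by ring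
      _ ≤ ((2 * m + m₂) * (1 + ℓ s ω)) * ((μ₀ * Real.exp κ + α) * (1 + ℓ s ω)) := by
          have e1 : m * p s ω ≤ m * ℓ s ω := by gcongr
          have e2 : 0 ≤ m₂ * ℓ s ω := by positivity
          have e3 : 0 ≤ μ₀ * Real.exp κ * ℓ s ω := by positivity
          gcongr <;> linarith
      _ ≤ D + D * ℓ s ω ^ 2 := by
          have : (1 + ℓ s ω) ^ 2 ≤ 2 * (1 + ℓ s ω ^ 2) := by nlinarith [sq_nonneg (1 - ℓ s ω)]
          have h0 : 0 ≤ (2 * m + m₂) * (μ₀ * Real.exp κ + α) := by positivity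
          have := mul_le_mul_of_nonneg_left this h0
          rw [hD]
          linarith
  have hmeas : Measurable fun q : ℝ × Ω => ENNReal.ofReal (ℓ q.1 q.2 ^ 2) :=
    ((hN.measurable_pointSum (hN.measurable_truncMark N)).pow_const 2).ennreal_ofReal
  have hεm : ∀ i n, MeasurableSet {ω | (τ n ω : ℝ) ≤ t ∧ ε n ω = i} := fun i n =>
    (measurableSet_le (hN.measurable_tau n) measurable_const).inter
      (hN.measurable_type n (measurableSet_singleton i))
  have hτm : ∀ n, Measurable fun ω => τ n ω := fun n => by
    have := (hN.measurable_tau n).real_toNNReal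
    simpa using this
  have hA : ∀ i, Measurable fun ω => ∑' n, if (τ n ω : ℝ) ≤ t ∧ ε n ω = i then
      Z₁ (τ n ω, ω) * ENNReal.ofReal (ξ n ω) else 0 := fun i =>
    Measurable.tsum fun n => Measurable.ite (hεm i n) (Measurable.mul
      (Measurable.ite (measurableSet_lt (hτm N) (hτm n)) measurable_const
        (((hN.measurable_leftSum (hN.measurable_truncMark N)).comp
          ((hN.measurable_tau n).prodMk measurable_id)).const_mul 2).ennreal_ofReal)
      (hN.measurable_mark n).ennreal_ofReal) measurable_const
  have hB : ∀ i, Measurable fun ω => ∑' n, if (τ n ω : ℝ) ≤ t ∧ ε n ω = i then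
      Z₂ (τ n ω, ω) * ENNReal.ofReal (ξ n ω ^ 2) else 0 := fun i =>
    Measurable.tsum fun n => Measurable.ite (hεm i n) (Measurable.mul
      (Measurable.ite (measurableSet_lt (hτm N) (hτm n)) measurable_const measurable_const)
      ((hN.measurable_mark n).pow_const 2).ennreal_ofReal) measurable_const
  have hi : ∀ i, (∫⁻ ω, (∑' n, if (τ n ω : ℝ) ≤ t ∧ ε n ω = i then
          Z₁ (τ n ω, ω) * ENNReal.ofReal (ξ n ω) else 0) ∂P) +
        ∫⁻ ω, (∑' n, if (τ n ω : ℝ) ≤ t ∧ ε n ω = i then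
          Z₂ (τ n ω, ω) * ENNReal.ofReal (ξ n ω ^ 2) else 0) ∂P ≤
      ENNReal.ofReal (D * T) + ENNReal.ofReal D * ∫⁻ s in Set.Icc 0 t,
          ∫⁻ ω, ENNReal.ofReal (ℓ s ω ^ 2) ∂P := by
    intro i
    rw [h1 i, h2 i, hN.lintegral_mark, hN.lintegral_mark_sq, ← hm, ← hm₂,
      ← lintegral_const_mul' _ _ ENNReal.ofReal_ne_top,
      ← lintegral_const_mul' _ _ ENNReal.ofReal_ne_top]
    -- Superadditivity of the lower integral suffices and asks for no measurability.
    refine (le_lintegral_add _ _).trans ?_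
    calc _ ≤ ∫⁻ ω, (∫⁻ s in Set.Icc 0 t,
          (ENNReal.ofReal D + ENNReal.ofReal D * ENNReal.ofReal (ℓ s ω ^ 2))) ∂P := by
          refine lintegral_mono fun ω => ?_
          rw [← lintegral_const_mul' _ _ ENNReal.ofReal_ne_top,
            ← lintegral_const_mul' _ _ ENNReal.ofReal_ne_top]
          exact (le_lintegral_add _ _).trans
            (setLIntegral_mono' measurableSet_Icc fun s hs => hbound i ω s hs)
      _ = ∫⁻ s in Set.Icc 0 t, (∫⁻ ω,
          (ENNReal.ofReal D + ENNReal.ofReal D * ENNReal.ofReal (ℓ s ω ^ 2)) ∂P) := by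
          refine lintegral_lintegral_swap (Measurable.aemeasurable ?_)
          exact ((hmeas.comp measurable_swap).const_mul _).const_add _
      _ = ENNReal.ofReal (D * t) + ENNReal.ofReal D * ∫⁻ s in Set.Icc 0 t,
          ∫⁻ ω, ENNReal.ofReal (ℓ s ω ^ 2) ∂P := by
          have : ∀ s, (∫⁻ ω, (ENNReal.ofReal D +
              ENNReal.ofReal D * ENNReal.ofReal (ℓ s ω ^ 2)) ∂P) = ENNReal.ofReal D +
              ENNReal.ofReal D * ∫⁻ ω, ENNReal.ofReal (ℓ s ω ^ 2) ∂P := fun s => by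
            rw [lintegral_add_left measurable_const, lintegral_const, measure_univ, mul_one,
              lintegral_const_mul' _ _ ENNReal.ofReal_ne_top]
          simp only [this]
          rw [lintegral_add_left measurable_const, lintegral_const_mul' _ _ ENNReal.ofReal_ne_top,
            lintegral_const, Measure.restrict_apply_univ, Real.volume_Icc, sub_zero,
            ← ENNReal.ofReal_mul hD0]
      _ ≤ _ := by
          gcongr
          exact ht.2
  change ∫⁻ ω, ENNReal.ofReal (ℓ t ω ^ 2) ∂P ≤ _
  simp only [hsq]
  rw [lintegral_finsetSum _ fun i _ => by exact (hA i).add (hB i), Fin.sum_univ_two,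
    lintegral_add_left (hA 0), lintegral_add_left (hA 1)]
  refine (add_le_add (hi 0) (hi 1)).trans ?_
  calc _ = ENNReal.ofReal (2 * D * T) + ENNReal.ofReal (2 * D) * ∫⁻ s in Set.Icc 0 t,
          ∫⁻ ω, ENNReal.ofReal (ℓ s ω ^ 2) ∂P := by
        rw [mul_assoc 2 D T, ENNReal.ofReal_mul zero_le_two, ENNReal.ofReal_mul zero_le_two]
        simp only [ENNReal.ofReal_ofNat]
        ring
    _ ≤ _ := by
        gcongr <;> linarith

/-- The sum of all marks up to the horizon is square integrable. -/
lemma memLp_pointSum [IsProbabilityMeasure P]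
    (hN : IsMarkedHawkes P ℱ T (expBaseline μ₀ κ) (expKernel α β) τ ε ξ J) (hT : 0 < T)
    (hμ₀ : 0 < μ₀) (hκ : 0 < κ) (hα : 0 < α) (hβ : 0 < β) :
    MemLp (fun ω => pointSum (fun n => (τ n ω : ℝ)) (fun n => ξ n ω) T) 2 P := by
  obtain ⟨C, hC, hle⟩ := hN.lintegral_truncMark_sq_le hT hμ₀ hκ hα hβ
  have hTT : T ∈ Set.Icc 0 T := ⟨hT.le, le_rfl⟩
  have hbound : ∀ N, ∫⁻ ω, ENNReal.ofReal
      (pointSum (fun n => (τ n ω : ℝ)) (truncMark ξ N ω) T ^ 2) ∂P ≤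
      ENNReal.ofReal (Real.exp (2 * C * (T - 0))) * (2 * ENNReal.ofReal (C * T)) := by
    intro N
    -- The a priori finite bound required by Grönwall is the second moment of N + 1 marks. It
    -- depends on N, but the conclusion does not.
    have hR : MemLp (fun ω => ∑ n ∈ Finset.range (N + 1), ξ n ω) 2 P :=
      memLp_finsetSum _ fun n _ => hN.memLp_mark n
    refine gronwall_lintegral (a := 0) (b := T) hC (M := ∫⁻ ω, ENNReal.ofReal
      ((∑ n ∈ Finset.range (N + 1), ξ n ω) ^ 2) ∂P) ?_ (fun t ht => ?_) (hle N) T hTT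
    · rw [← ofReal_integral_eq_lintegral_ofReal hR.integrable_sq
        (Filter.Eventually.of_forall fun ω => sq_nonneg _)]
      exact ENNReal.ofReal_ne_top
    · refine lintegral_mono fun ω => ENNReal.ofReal_le_ofReal ?_
      refine pow_le_pow_left₀ (pointSum_nonneg (hN.truncMark_nonneg N ω)) ?_ 2
      rw [pointSum, tsum_eq_sum (s := Finset.range (N + 1)) fun n hn => ?_]
      · refine Finset.sum_le_sum fun n _ => ?_
        have := (hN.mark_pos n ω).le
        rw [truncMark]
        split_ifs <;> simp [this]
      · have : ¬ n ≤ N := by simpa [Nat.lt_succ_iff] using hn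
        simp [truncMark, this]
  have hm : Measurable fun ω => pointSum (fun n => (τ n ω : ℝ)) (fun n => ξ n ω) T :=
    (hN.measurable_pointSum (v := fun ω n => ξ n ω) hN.measurable_mark).comp
      (measurable_const.prodMk measurable_id)
  have hfin : ∫⁻ ω, ENNReal.ofReal
      (pointSum (fun n => (τ n ω : ℝ)) (fun n => ξ n ω) T ^ 2) ∂P ≤
      ENNReal.ofReal (Real.exp (2 * C * (T - 0))) * (2 * ENNReal.ofReal (C * T)) := by
    -- For each ω the truncated sums are eventually constant, since only finitely many arrivals
    -- occur by T; Fatou's lemma then applies.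
    have hlim : ∀ ω, Filter.Tendsto (fun N => ENNReal.ofReal
        (pointSum (fun n => (τ n ω : ℝ)) (truncMark ξ N ω) T ^ 2)) Filter.atTop
        (nhds (ENNReal.ofReal (pointSum (fun n => (τ n ω : ℝ)) (fun n => ξ n ω) T ^ 2))) := by
      intro ω
      refine tendsto_const_nhds.congr' ?_
      obtain ⟨K, hK⟩ := exists_count (hN.strictMono ω) (hN.locallyFinite ω)
      filter_upwards [Filter.eventually_ge_atTop K] with N hKN
      congr 2
      refine tsum_congr fun n => ?_
      by_cases h : (τ n ω : ℝ) ≤ T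
      · have : n ≤ N := ((hK n).1 h).le.trans hKN
        simp [truncMark, this]
      · simp [h]
    calc _ = ∫⁻ ω, Filter.liminf (fun N => ENNReal.ofReal
        (pointSum (fun n => (τ n ω : ℝ)) (truncMark ξ N ω) T ^ 2)) Filter.atTop ∂P :=
          lintegral_congr fun ω => (hlim ω).liminf_eq.symm
      _ ≤ Filter.liminf (fun N => ∫⁻ ω, ENNReal.ofReal
        (pointSum (fun n => (τ n ω : ℝ)) (truncMark ξ N ω) T ^ 2) ∂P) Filter.atTop :=
          lintegral_liminf_le fun N => (((hN.measurable_pointSum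
            (hN.measurable_truncMark N)).comp
            (measurable_const.prodMk measurable_id)).pow_const 2).ennreal_ofReal
      _ ≤ _ := Filter.liminf_le_of_le (by isBoundedDefault) fun b hb => by
          obtain ⟨N, hN'⟩ := hb.exists
          exact hN'.trans (hbound N)
  rw [memLp_two_iff_integrable_sq hm.aestronglyMeasurable]
  refine ⟨(hm.pow_const 2).aestronglyMeasurable, ?_⟩
  rw [hasFiniteIntegral_iff_ofReal (Filter.Eventually.of_forall fun ω => sq_nonneg _)]
  exact hfin.trans_lt (by finiteness)

end IsMarkedHawkes

/-! ### Processes dominated by a power of a square integrable variable -/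

/-- `F` is jointly measurable and bounded on `[0, T]` by a multiple of `(1 + L) ^ k`. -/
def IsDominated {Ω : Type*} [MeasurableSpace Ω] (T : ℝ) (L : Ω → ℝ) (k : ℕ) (F : ℝ → Ω → ℝ) : Prop :=
  Measurable (fun p : ℝ × Ω => F p.1 p.2) ∧
    ∃ C, 0 ≤ C ∧ ∀ s ∈ Set.Icc 0 T, ∀ ω, |F s ω| ≤ C * (1 + L ω) ^ k

namespace IsDominated

variable {Ω : Type*} [mΩ : MeasurableSpace Ω] {T : ℝ} {L : Ω → ℝ} {k l : ℕ} {F G : ℝ → Ω → ℝ}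

lemma mul (hF : IsDominated T L k F) (hG : IsDominated T L l G) :
    IsDominated T L (k + l) fun s ω => F s ω * G s ω := by
  obtain ⟨hFm, C, hC, hF⟩ := hF
  obtain ⟨hGm, D, hD, hG⟩ := hG
  refine ⟨hFm.mul hGm, C * D, by positivity, fun s hs ω => ?_⟩
  rw [abs_mul]
  have := mul_le_mul (hF s hs ω) (hG s hs ω) (abs_nonneg _) ((abs_nonneg _).trans (hF s hs ω))
  calc _ ≤ _ := this
    _ = _ := by ring

lemma add (hF : IsDominated T L k F) (hG : IsDominated T L k G) :
    IsDominated T L k fun s ω => F s ω + G s ω := by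
  obtain ⟨hFm, C, hC, hF⟩ := hF
  obtain ⟨hGm, D, hD, hG⟩ := hG
  refine ⟨hFm.add hGm, C + D, by positivity, fun s hs ω => ?_⟩
  rw [add_mul]
  exact (abs_add_le _ _).trans (add_le_add (hF s hs ω) (hG s hs ω))

lemma of_bounded {h : ℝ → ℝ} (hm : Measurable h) (hb : ∃ C, ∀ s ∈ Set.Icc 0 T, |h s| ≤ C) :
    IsDominated T L 0 fun s _ => h s := by
  obtain ⟨C, hC⟩ := hb
  exact ⟨hm.comp measurable_fst, |C|, abs_nonneg _, fun s hs _ => by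
    simpa using (hC s hs).trans (le_abs_self C)⟩

lemma of_abs_le (hF : IsDominated T L k F) (hG : Measurable fun p : ℝ × Ω => G p.1 p.2)
    (h : ∀ s ω, |G s ω| ≤ |F s ω|) : IsDominated T L k G := by
  obtain ⟨-, C, hC, hF⟩ := hF
  exact ⟨hG, C, hC, fun s hs ω => (h s ω).trans (hF s hs ω)⟩

lemma mono (hL : ∀ ω, 0 ≤ L ω) (hkl : k ≤ l) (hF : IsDominated T L k F) : IsDominated T L l F := by
  obtain ⟨hFm, C, hC, hF⟩ := hF
  refine ⟨hFm, C, hC, fun s hs ω => (hF s hs ω).trans ?_⟩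
  gcongr
  linarith [hL ω]

/-- Lets a variable observed at a fixed time s be multiplied by a process running in r, as in E(X_s
Y_r). -/
lemma freeze (hF : IsDominated T L k F) {s : ℝ} (hs : s ∈ Set.Icc 0 T) :
    IsDominated T L k fun _ => F s := by
  obtain ⟨hFm, C, hC, hF⟩ := hF
  exact ⟨hFm.of_uncurry_left.comp measurable_snd, C, hC, fun _ _ ω => hF s hs ω⟩

lemma comp_toNNReal (hF : IsDominated T L k F) :
    IsDominated T L k fun s ω => F (s.toNNReal : ℝ) ω := by
  obtain ⟨hFm, C, hC, hF⟩ := hF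
  refine ⟨hFm.comp (measurable_fst.real_toNNReal.coe_nnreal_real.prodMk measurable_snd), C, hC,
    fun s hs ω => ?_⟩
  simp only [Real.coe_toNNReal _ hs.1]
  exact hF s hs ω

lemma const_mul (a : ℝ) (hF : IsDominated T L k F) : IsDominated T L k fun s ω => a * F s ω := by
  have : IsDominated T L (0 + k) fun s ω => (fun _ => a) s * F s ω :=
    (of_bounded measurable_const ⟨|a|, fun _ _ => le_rfl⟩).mul hF
  simpa using this

variable {P : Measure Ω} [IsProbabilityMeasure P]

lemma integrable_majorant (hL : MemLp L 2 P) (C : ℝ) :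
    Integrable (fun ω => C * (1 + L ω) ^ 2) P := by
  have h : MemLp (fun ω => 1 + L ω) 2 P := (memLp_const (1 : ℝ)).add hL
  exact h.integrable_sq.const_mul C

lemma integrable (hL : MemLp L 2 P) (hF : IsDominated T L 2 F) {s : ℝ} (hs : s ∈ Set.Icc 0 T) :
    Integrable (F s) P := by
  obtain ⟨hFm, C, hC, hF⟩ := hF
  exact (integrable_majorant hL C).mono' (hFm.of_uncurry_left).aestronglyMeasurable
    (Filter.Eventually.of_forall (hF s hs))

lemma integrable_prod (hL : MemLp L 2 P) (hF : IsDominated T L 2 F) :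
    Integrable (fun p : ℝ × Ω => F p.1 p.2) ((volume.restrict (Set.Ioc 0 T)).prod P) := by
  obtain ⟨hFm, C, hC, hF⟩ := hF
  refine ((integrable_majorant hL C).comp_snd (volume.restrict (Set.Ioc 0 T))).mono'
    hFm.aestronglyMeasurable ?_
  have : ∀ᵐ p ∂((volume.restrict (Set.Ioc 0 T)).prod P), p.1 ∈ Set.Ioc 0 T :=
    Measure.quasiMeasurePreserving_fst.ae (ae_restrict_mem measurableSet_Ioc)
  filter_upwards [this] with p hp using hF _ ⟨hp.1.le, hp.2⟩ _

lemma intervalIntegrable (hL : MemLp L 2 P) (hF : IsDominated T L 2 F) {a b : ℝ} (ha : 0 ≤ a)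
    (hab : a ≤ b) (hb : b ≤ T) : IntervalIntegrable (fun s => ∫ ω, F s ω ∂P) volume a b := by
  rw [intervalIntegrable_iff_integrableOn_Ioc_of_le hab]
  exact (hF.integrable_prod hL).integral_prod_left.mono_measure
    (Measure.restrict_mono (Set.Ioc_subset_Ioc ha hb) le_rfl)

lemma exists_bound (hL : MemLp L 2 P) (hF : IsDominated T L 2 F) :
    ∃ C, ∀ s ∈ Set.Icc 0 T, |∫ ω, F s ω ∂P| ≤ C := by
  obtain ⟨hFm, C, hC, hF⟩ := hF
  refine ⟨∫ ω, C * (1 + L ω) ^ 2 ∂P, fun s hs => ?_⟩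
  rw [← Real.norm_eq_abs]
  exact norm_integral_le_of_norm_le (integrable_majorant hL C)
    (Filter.Eventually.of_forall fun ω => hF s hs ω)

lemma integral_swap (hL : MemLp L 2 P) (hF : IsDominated T L 2 F) {t : ℝ} (ht : t ∈ Set.Icc 0 T) :
    ∫ ω, (∫ s in 0..t, F s ω) ∂P = ∫ s in 0..t, ∫ ω, F s ω ∂P := by
  simp only [intervalIntegral.integral_of_le ht.1]
  have hi := hF.integrable_prod hL
  have hle : (volume.restrict (Set.Ioc 0 t)).prod P ≤ (volume.restrict (Set.Ioc 0 T)).prod P :=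
    Measure.prod_mono (Measure.restrict_mono (Set.Ioc_subset_Ioc_right ht.2) le_rfl) le_rfl
  exact (integral_integral_swap (hi.mono_measure hle)).symm

end IsDominated

/-! ### The compensator formula for dominated integrands -/

lemma measurable_of_predictable {Ω E : Type*} [mΩ : MeasurableSpace Ω] [MeasurableSpace E]
    {ℱ : Filtration ℝ≥0 mΩ} {Z : ℝ≥0 × Ω → E} (hZ : Measurable[ℱ.predictable] Z) :
    Measurable fun p : ℝ × Ω => Z (p.1.toNNReal, p.2) := by
  have hle : ℱ.predictable ≤ (inferInstance : MeasurableSpace (ℝ≥0 × Ω)) :=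
    measurableSpace_le_predictable_of_measurableSet
      (fun A hA => (measurableSet_singleton _).prod (ℱ.le _ _ hA))
      (fun i A hA => measurableSet_Ioi.prod (ℱ.le _ _ hA))
  have : Measurable Z := hZ.mono hle le_rfl
  exact this.comp (measurable_fst.real_toNNReal.prodMk measurable_snd)

/-- Serves the four pieces obtained by splitting according to type and to the sign of the integrand,
both over Ω and over time. -/
lemma integral_linear_comb {X : Type*} [MeasurableSpace X] {μ : Measure X} {f₁ f₂ f₃ f₄ : X → ℝ}
    (h₁ : Integrable f₁ μ) (h₂ : Integrable f₂ μ) (h₃ : Integrable f₃ μ) (h₄ : Integrable f₄ μ)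
    (a b : ℝ) :
    Integrable (fun x => a * (f₁ x - f₂ x) + b * (f₃ x - f₄ x)) μ ∧
      ∫ x, a * (f₁ x - f₂ x) + b * (f₃ x - f₄ x) ∂μ =
        a * ((∫ x, f₁ x ∂μ) - ∫ x, f₂ x ∂μ) + b * ((∫ x, f₃ x ∂μ) - ∫ x, f₄ x ∂μ) := by
  have h12 : Integrable (fun x => a * (f₁ x - f₂ x)) μ := (h₁.sub h₂).const_mul a
  have h34 : Integrable (fun x => b * (f₃ x - f₄ x)) μ := (h₃.sub h₄).const_mul b
  refine ⟨h12.add h34, ?_⟩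
  rw [integral_add h12 h34, integral_const_mul, integral_const_mul, integral_sub h₁ h₂,
    integral_sub h₃ h₄]

/-- The sum of all marks up to the horizon `T`. -/
def totalMark {Ω : Type*} (T : ℝ) (τ : ℕ → Ω → ℝ≥0) (ξ : ℕ → Ω → ℝ) (ω : Ω) : ℝ :=
  pointSum (fun n => (τ n ω : ℝ)) (fun n => ξ n ω) T

/-- The linear combination `c(0) λ⁺ + c(1) λ⁻` of the intensities. -/
def combIntensity {Ω : Type*} (T μ₀ κ α β : ℝ) (τ : ℕ → Ω → ℝ≥0) (ε : ℕ → Ω → Fin 2)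
    (ξ : ℕ → Ω → ℝ) (c : Fin 2 → ℝ) (t : ℝ) (ω : Ω) : ℝ :=
  c 0 * intensity T (expBaseline μ₀ κ) (expKernel α β) τ ε ξ 0 t ω +
    c 1 * intensity T (expBaseline μ₀ κ) (expKernel α β) τ ε ξ 1 t ω

namespace IsMarkedHawkes

variable {Ω : Type*} [mΩ : MeasurableSpace Ω] {P : Measure Ω}
  {ℱ : Filtration ℝ≥0 mΩ} {T μ₀ κ α β : ℝ}
  {τ : ℕ → Ω → ℝ≥0} {ε : ℕ → Ω → Fin 2} {ξ : ℕ → Ω → ℝ} {J : Ω → ℝ}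

lemma totalMark_nonneg (hN : IsMarkedHawkes P ℱ T (expBaseline μ₀ κ) (expKernel α β) τ ε ξ J)
    (ω : Ω) : 0 ≤ totalMark T τ ξ ω :=
  pointSum_nonneg fun n => (hN.mark_pos n ω).le

lemma isDominated_intensity
    (hN : IsMarkedHawkes P ℱ T (expBaseline μ₀ κ) (expKernel α β) τ ε ξ J) (hT : 0 < T)
    (hμ₀ : 0 < μ₀) (hκ : 0 < κ) (hα : 0 < α) (hβ : 0 < β) (i : Fin 2) :
    IsDominated T (totalMark T τ ξ) 1
      (intensity T (expBaseline μ₀ κ) (expKernel α β) τ ε ξ i) := by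
  refine ⟨hN.measurable_intensity i, μ₀ * Real.exp κ + α, by positivity, fun s hs ω => ?_⟩
  rw [abs_of_nonneg (hN.intensity_nonneg hμ₀ hα i s ω), pow_one]
  have h1 := hN.intensity_le hT hμ₀ hκ hα hβ i hs.2 ω (v := fun n => ξ n ω) fun _ _ => le_rfl
  have h2 : pointSum (fun n => (τ n ω : ℝ)) (fun n => ξ n ω) s ≤ totalMark T τ ξ ω :=
    (le_abs_self _).trans (abs_pointSum_le (hN.strictMono ω) (hN.locallyFinite ω) hs.2
      fun n _ => (abs_of_pos (hN.mark_pos n ω)).le)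
  have h3 := hN.totalMark_nonneg ω
  have h4 := mul_le_mul_of_nonneg_left h2 hα.le
  have h5 : 0 ≤ μ₀ * Real.exp κ * totalMark T τ ξ ω := by positivity
  linarith

lemma isDominated_combIntensity
    (hN : IsMarkedHawkes P ℱ T (expBaseline μ₀ κ) (expKernel α β) τ ε ξ J) (hT : 0 < T)
    (hμ₀ : 0 < μ₀) (hκ : 0 < κ) (hα : 0 < α) (hβ : 0 < β) (c : Fin 2 → ℝ) :
    IsDominated T (totalMark T τ ξ) 1 (combIntensity T μ₀ κ α β τ ε ξ c) :=
  ((hN.isDominated_intensity hT hμ₀ hκ hα hβ 0).const_mul (c 0)).add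
    ((hN.isDominated_intensity hT hμ₀ hκ hα hβ 1).const_mul (c 1))

variable [IsProbabilityMeasure P]

lemma memLp_totalMark
    (hN : IsMarkedHawkes P ℱ T (expBaseline μ₀ κ) (expKernel α β) τ ε ξ J) (hT : 0 < T)
    (hμ₀ : 0 < μ₀) (hκ : 0 < κ) (hα : 0 < α) (hβ : 0 < β) : MemLp (totalMark T τ ξ) 2 P :=
  hN.memLp_pointSum hT hμ₀ hκ hα hβ

/-- The `ℝ≥0∞` compensator formula becomes a Bochner one because its right side is finite: the
integrand and the intensity are each dominated to order 1, and their product to order 2 is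
integrable. -/
lemma integral_pointSum_of_nonneg
    (hN : IsMarkedHawkes P ℱ T (expBaseline μ₀ κ) (expKernel α β) τ ε ξ J) (hT : 0 < T)
    (hμ₀ : 0 < μ₀) (hκ : 0 < κ) (hα : 0 < α) (hβ : 0 < β) (i : Fin 2)
    {Z : ℝ≥0 × Ω → ℝ} (hZ : Measurable[ℱ.predictable] Z) (hZ0 : ∀ q, 0 ≤ Z q)
    (hdom : IsDominated T (totalMark T τ ξ) 1 fun s ω => Z (s.toNNReal, ω))
    {g : ℝ → ℝ} (hg : Measurable g) (hg0 : ∀ x, 0 ≤ x → 0 ≤ g x)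
    (hgi : Integrable (fun ω => g (ξ 0 ω)) P) {t : ℝ} (ht : t ∈ Set.Icc 0 T) :
    Integrable (fun ω => pointSum (fun n => (τ n ω : ℝ))
        (fun n => if ε n ω = i then Z (τ n ω, ω) * g (ξ n ω) else 0) t) P ∧
      ∫ ω, pointSum (fun n => (τ n ω : ℝ))
        (fun n => if ε n ω = i then Z (τ n ω, ω) * g (ξ n ω) else 0) t ∂P =
      (∫ ω, g (ξ 0 ω) ∂P) * ∫ ω, (∫ s in 0..t, Z (s.toNNReal, ω) *
        intensity T (expBaseline μ₀ κ) (expKernel α β) τ ε ξ i s ω) ∂P := by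
  classical
  set lam := intensity T (expBaseline μ₀ κ) (expKernel α β) τ ε ξ i with hlam
  set S : Ω → ℝ := fun ω => pointSum (fun n => (τ n ω : ℝ))
    (fun n => if ε n ω = i then Z (τ n ω, ω) * g (ξ n ω) else 0) t with hS
  set F : ℝ → Ω → ℝ := fun s ω => Z (s.toNNReal, ω) * lam s ω with hF
  have hgξ : ∀ n ω, 0 ≤ g (ξ n ω) := fun n ω => hg0 _ (hN.mark_pos n ω).le
  have hFdom : IsDominated T (totalMark T τ ξ) 2 F :=
    hdom.mul (hN.isDominated_intensity hT hμ₀ hκ hα hβ i)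
  have hF0 : ∀ s ω, 0 ≤ F s ω := fun s ω =>
    mul_nonneg (hZ0 _) (hN.intensity_nonneg hμ₀ hα i s ω)
  have hv0 : ∀ ω n, 0 ≤ if ε n ω = i then Z (τ n ω, ω) * g (ξ n ω) else 0 := fun ω n => by
    have := mul_nonneg (hZ0 (τ n ω, ω)) (hgξ n ω)
    split_ifs <;> simp [this]
  have hS0 : ∀ ω, 0 ≤ S ω := fun ω => pointSum_nonneg (hv0 ω)
  have hSm : Measurable S := by
    refine (hN.measurable_pointSum (v := fun ω n =>
      if ε n ω = i then Z (τ n ω, ω) * g (ξ n ω) else 0) fun n => ?_).comp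
      (measurable_const.prodMk measurable_id)
    refine Measurable.ite (hN.measurable_type n (measurableSet_singleton i)) (Measurable.mul ?_
      (hg.comp (hN.measurable_mark n))) measurable_const
    have := hdom.1.comp ((hN.measurable_tau n).prodMk measurable_id)
    simpa [Function.comp_def] using this
  set ν : Measure ℝ := volume.restrict (Set.Ioc 0 t) with hν
  have hFi : Integrable (fun p : Ω × ℝ => F p.2 p.1) (P.prod ν) :=
    ((hFdom.integrable_prod (hN.memLp_totalMark hT hμ₀ hκ hα hβ)).mono_measure
      (Measure.prod_mono (Measure.restrict_mono (Set.Ioc_subset_Ioc_right ht.2) le_rfl)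
        le_rfl)).swap
  have hlin : ∫⁻ ω, ENNReal.ofReal (S ω) ∂P =
      ENNReal.ofReal ((∫ ω, g (ξ 0 ω) ∂P) * ∫ ω, (∫ s in 0..t, F s ω) ∂P) := by
    have h1 := hN.lintegral_tsum_eq i (Z := fun q => ENNReal.ofReal (Z q)) hZ.ennreal_ofReal
      (g := fun x => ENNReal.ofReal (g x)) hg.ennreal_ofReal
      (by rw [← ofReal_integral_eq_lintegral_ofReal hgi (Filter.Eventually.of_forall (hgξ 0))]
          exact ENNReal.ofReal_ne_top) ht.2
    have h2 : ∀ ω, ENNReal.ofReal (S ω) = ∑' n, if (τ n ω : ℝ) ≤ t ∧ ε n ω = i then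
        ENNReal.ofReal (Z (τ n ω, ω)) * ENNReal.ofReal (g (ξ n ω)) else 0 := fun ω => by
      rw [hS, ofReal_pointSum (hN.locallyFinite ω) ht.2 (hv0 ω)]
      refine tsum_congr fun n => ?_
      by_cases h3 : (τ n ω : ℝ) ≤ t <;> by_cases h4 : ε n ω = i <;>
        simp [h3, h4, ENNReal.ofReal_mul (hZ0 _)]
    simp only [h2]
    rw [h1, ENNReal.ofReal_mul (integral_nonneg (hgξ 0)),
      ofReal_integral_eq_lintegral_ofReal hgi (Filter.Eventually.of_forall (hgξ 0))]
    congr 1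
    have h5 : ∫ ω, (∫ s in 0..t, F s ω) ∂P = ∫ p, F p.2 p.1 ∂(P.prod ν) := by
      simp only [intervalIntegral.integral_of_le ht.1]
      exact (integral_prod _ hFi).symm
    rw [h5, ofReal_integral_eq_lintegral_ofReal hFi
      (Filter.Eventually.of_forall fun p => hF0 _ _), lintegral_prod _
      hFi.aestronglyMeasurable.aemeasurable.ennreal_ofReal]
    refine lintegral_congr fun ω => ?_
    rw [setLIntegral_congr Ioc_ae_eq_Icc.symm]
    exact lintegral_congr fun s => (ENNReal.ofReal_mul (hZ0 _)).symm
  refine ⟨⟨hSm.aestronglyMeasurable, ?_⟩, ?_⟩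
  · rw [hasFiniteIntegral_iff_ofReal (Filter.Eventually.of_forall hS0), hlin]
    exact ENNReal.ofReal_lt_top
  · rw [integral_eq_lintegral_of_nonneg_ae (Filter.Eventually.of_forall hS0)
      hSm.aestronglyMeasurable, hlin, ENNReal.toReal_ofReal]
    refine mul_nonneg (integral_nonneg (hgξ 0)) (integral_nonneg fun ω => ?_)
    exact intervalIntegral.integral_nonneg ht.1 fun s _ => hF0 s ω

/-- The compensator formula for signed integrands. -/
lemma integral_pointSum_eq
    (hN : IsMarkedHawkes P ℱ T (expBaseline μ₀ κ) (expKernel α β) τ ε ξ J) (hT : 0 < T)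
    (hμ₀ : 0 < μ₀) (hκ : 0 < κ) (hα : 0 < α) (hβ : 0 < β) (c : Fin 2 → ℝ)
    {Z : ℝ≥0 × Ω → ℝ} (hZ : Measurable[ℱ.predictable] Z)
    (hdom : IsDominated T (totalMark T τ ξ) 1 fun s ω => Z (s.toNNReal, ω))
    {g : ℝ → ℝ} (hg : Measurable g) (hg0 : ∀ x, 0 ≤ x → 0 ≤ g x)
    (hgi : Integrable (fun ω => g (ξ 0 ω)) P) {t : ℝ} (ht : t ∈ Set.Icc 0 T) :
    Integrable (fun ω => pointSum (fun n => (τ n ω : ℝ))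
        (fun n => c (ε n ω) * (Z (τ n ω, ω) * g (ξ n ω))) t) P ∧
      ∫ ω, pointSum (fun n => (τ n ω : ℝ))
        (fun n => c (ε n ω) * (Z (τ n ω, ω) * g (ξ n ω))) t ∂P =
      (∫ ω, g (ξ 0 ω) ∂P) * ∫ ω, (∫ s in 0..t, Z (s.toNNReal, ω) *
        combIntensity T μ₀ κ α β τ ε ξ c s ω) ∂P := by
  classical
  have hL := hN.memLp_totalMark hT hμ₀ hκ hα hβ
  have hZp : Measurable[ℱ.predictable] fun q => max (Z q) 0 := by
    let : MeasurableSpace (ℝ≥0 × Ω) := ℱ.predictable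
    exact hZ.max measurable_const
  have hZn : Measurable[ℱ.predictable] fun q => max (-Z q) 0 := by
    let : MeasurableSpace (ℝ≥0 × Ω) := ℱ.predictable
    exact hZ.neg.max measurable_const
  have hdp : IsDominated T (totalMark T τ ξ) 1 fun s ω => max (Z (s.toNNReal, ω)) 0 :=
    hdom.of_abs_le (measurable_of_predictable hZp) fun s ω => by
      rw [abs_of_nonneg (le_max_right _ _)]; exact max_le (le_abs_self _) (abs_nonneg _)
  have hdn : IsDominated T (totalMark T τ ξ) 1 fun s ω => max (-Z (s.toNNReal, ω)) 0 :=
    hdom.of_abs_le (measurable_of_predictable hZn) fun s ω => by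
      rw [abs_of_nonneg (le_max_right _ _)]; exact max_le (neg_le_abs _) (abs_nonneg _)
  have hp := fun i => hN.integral_pointSum_of_nonneg hT hμ₀ hκ hα hβ i hZp
    (fun _ => le_max_right _ _) hdp hg hg0 hgi ht
  have hn := fun i => hN.integral_pointSum_of_nonneg hT hμ₀ hκ hα hβ i hZn
    (fun _ => le_max_right _ _) hdn hg hg0 hgi ht
  -- Splitting into positive and negative parts preserves predictability and domination, so the
  -- nonnegative case applies four times.
  have hdec : ∀ x : ℝ, x = max x 0 - max (-x) 0 := fun x => by
    rcases le_total 0 x with h | h <;> simp [h]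
  have hsum : ∀ ω, pointSum (fun n => (τ n ω : ℝ))
      (fun n => c (ε n ω) * (Z (τ n ω, ω) * g (ξ n ω))) t =
      c 0 * (pointSum (fun n => (τ n ω : ℝ))
          (fun n => if ε n ω = 0 then max (Z (τ n ω, ω)) 0 * g (ξ n ω) else 0) t -
        pointSum (fun n => (τ n ω : ℝ))
          (fun n => if ε n ω = 0 then max (-Z (τ n ω, ω)) 0 * g (ξ n ω) else 0) t) +
      c 1 * (pointSum (fun n => (τ n ω : ℝ))
          (fun n => if ε n ω = 1 then max (Z (τ n ω, ω)) 0 * g (ξ n ω) else 0) t -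
        pointSum (fun n => (τ n ω : ℝ))
          (fun n => if ε n ω = 1 then max (-Z (τ n ω, ω)) 0 * g (ξ n ω) else 0) t) := by
    intro ω
    obtain ⟨K, hK⟩ := exists_forall_pointSum_eq (hN.strictMono ω) (hN.locallyFinite ω) ht.2
    simp only [hK, ← Finset.sum_sub_distrib, Finset.mul_sum, ← Finset.sum_add_distrib]
    refine Finset.sum_congr rfl fun n _ => ?_
    split_ifs with h1 h2 h3
    · exact absurd (h2.symm.trans h3) (by decide)
    · rw [h2]
      conv_lhs => rw [hdec (Z (τ n ω, ω))]
      ring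
    · rw [‹ε n ω = 1›]
      conv_lhs => rw [hdec (Z (τ n ω, ω))]
      ring
    · exact absurd (Fin.exists_fin_two.1 ⟨ε n ω, rfl⟩) (by
        rintro (h | h)
        exacts [‹¬ ε n ω = 0› h, ‹¬ ε n ω = 1› h])
    · simp
  simp only [hsum]
  have hcomb := integral_linear_comb (hp 0).1 (hn 0).1 (hp 1).1 (hn 1).1 (c 0) (c 1)
  refine ⟨hcomb.1, ?_⟩
  have hI : ∀ (W : ℝ → Ω → ℝ) (i : Fin 2), IsDominated T (totalMark T τ ξ) 1 W →
      IsDominated T (totalMark T τ ξ) 2 fun s ω => W s ω *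
        intensity T (expBaseline μ₀ κ) (expKernel α β) τ ε ξ i s ω :=
    fun W i hW => hW.mul (hN.isDominated_intensity hT hμ₀ hκ hα hβ i)
  have hsplit : ∀ s ω, Z (s.toNNReal, ω) * combIntensity T μ₀ κ α β τ ε ξ c s ω =
      c 0 * (max (Z (s.toNNReal, ω)) 0 *
          intensity T (expBaseline μ₀ κ) (expKernel α β) τ ε ξ 0 s ω -
        max (-Z (s.toNNReal, ω)) 0 *
          intensity T (expBaseline μ₀ κ) (expKernel α β) τ ε ξ 0 s ω) +
      c 1 * (max (Z (s.toNNReal, ω)) 0 *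
          intensity T (expBaseline μ₀ κ) (expKernel α β) τ ε ξ 1 s ω -
        max (-Z (s.toNNReal, ω)) 0 *
          intensity T (expBaseline μ₀ κ) (expKernel α β) τ ε ξ 1 s ω) := fun s ω => by
    rw [combIntensity]
    conv_lhs => rw [hdec (Z (s.toNNReal, ω))]
    ring
  have hii : ∀ {W : ℝ → Ω → ℝ}, IsDominated T (totalMark T τ ξ) 2 W →
      Integrable (fun s => ∫ ω, W s ω ∂P) (volume.restrict (Set.Ioc 0 t)) := fun hW =>
    (hW.integrable_prod hL).integral_prod_left.mono_measure
      (Measure.restrict_mono (Set.Ioc_subset_Ioc_right ht.2) le_rfl)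
  have hcd : IsDominated T (totalMark T τ ξ) 2 fun s ω => Z (s.toNNReal, ω) *
      combIntensity T μ₀ κ α β τ ε ξ c s ω :=
    hdom.mul (hN.isDominated_combIntensity hT hμ₀ hκ hα hβ c)
  rw [hcomb.2, (hp 0).2, (hn 0).2, (hp 1).2, (hn 1).2,
    (hI _ 0 hdp).integral_swap hL ht, (hI _ 0 hdn).integral_swap hL ht,
    (hI _ 1 hdp).integral_swap hL ht, (hI _ 1 hdn).integral_swap hL ht,
    hcd.integral_swap hL ht]
  have hfin : ∫ s in 0..t, ∫ ω, Z (s.toNNReal, ω) * combIntensity T μ₀ κ α β τ ε ξ c s ω ∂P =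
      ∫ s in 0..t,
        (c 0 * ((∫ ω, max (Z (s.toNNReal, ω)) 0 *
          intensity T (expBaseline μ₀ κ) (expKernel α β) τ ε ξ 0 s ω ∂P) -
        ∫ ω, max (-Z (s.toNNReal, ω)) 0 *
          intensity T (expBaseline μ₀ κ) (expKernel α β) τ ε ξ 0 s ω ∂P) +
      c 1 * ((∫ ω, max (Z (s.toNNReal, ω)) 0 *
          intensity T (expBaseline μ₀ κ) (expKernel α β) τ ε ξ 1 s ω ∂P) -
        ∫ ω, max (-Z (s.toNNReal, ω)) 0 *
          intensity T (expBaseline μ₀ κ) (expKernel α β) τ ε ξ 1 s ω ∂P)) := by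
    refine intervalIntegral.integral_congr fun s hs => ?_
    rw [Set.uIcc_of_le ht.1] at hs
    have hs' : s ∈ Set.Icc 0 T := ⟨hs.1, hs.2.trans ht.2⟩
    simp only [hsplit]
    exact (integral_linear_comb ((hI _ 0 hdp).integrable hL hs')
      ((hI _ 0 hdn).integrable hL hs') ((hI _ 1 hdp).integrable hL hs')
      ((hI _ 1 hdn).integrable hL hs') (c 0) (c 1)).2
  rw [hfin]
  simp only [intervalIntegral.integral_of_le ht.1]
  rw [(integral_linear_comb (hii (hI _ 0 hdp)) (hii (hI _ 0 hdn)) (hii (hI _ 1 hdp))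
    (hii (hI _ 1 hdn)) (c 0) (c 1)).2]
  ring

end IsMarkedHawkes

/-! ### First and mixed second moments of sums over the arrivals -/

lemma pointSum_const_mul_mark {Ω : Type*} {T : ℝ} {τ : ℕ → Ω → ℝ≥0} {ξ : ℕ → Ω → ℝ} (D : ℝ) (ω : Ω) :
    pointSum (fun n => (τ n ω : ℝ)) (fun n => D * ξ n ω) T = D * totalMark T τ ξ ω := by
  rw [totalMark, pointSum, pointSum, ← tsum_mul_left]
  exact tsum_congr fun n => by split_ifs <;> simp

namespace IsMarkedHawkes

variable {Ω : Type*} [mΩ : MeasurableSpace Ω] {P : Measure Ω}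
  {ℱ : Filtration ℝ≥0 mΩ} {T μ₀ κ α β : ℝ}
  {τ : ℕ → Ω → ℝ≥0} {ε : ℕ → Ω → Fin 2} {ξ : ℕ → Ω → ℝ} {J : Ω → ℝ}

lemma exists_abs_weight_le
    (hN : IsMarkedHawkes P ℱ T (expBaseline μ₀ κ) (expKernel α β) τ ε ξ J) (c : Fin 2 → ℝ)
    {h : ℝ → ℝ} (hb : ∃ C, ∀ s ∈ Set.Icc 0 T, |h s| ≤ C) :
    ∃ D, 0 ≤ D ∧ ∀ ω n, (τ n ω : ℝ) ≤ T → |weight τ ε ξ c h ω n| ≤ D * ξ n ω := by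
  obtain ⟨C, hC⟩ := hb
  refine ⟨(|c 0| + |c 1|) * |C|, by positivity, fun ω n hn => ?_⟩
  have h1 : |c (ε n ω)| ≤ |c 0| + |c 1| := by
    have h2 := abs_nonneg (c 0)
    have h3 := abs_nonneg (c 1)
    rcases Fin.exists_fin_two.1 ⟨ε n ω, rfl⟩ with h | h <;> rw [h] <;> linarith
  have h4 : |h (τ n ω)| ≤ |C| := (hC _ ⟨(τ n ω).2, hn⟩).trans (le_abs_self C)
  rw [weight, abs_mul, abs_mul, abs_of_pos (hN.mark_pos n ω), mul_assoc, mul_comm |C|]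
  have := (hN.mark_pos n ω).le
  gcongr

lemma isDominated_markSum
    (hN : IsMarkedHawkes P ℱ T (expBaseline μ₀ κ) (expKernel α β) τ ε ξ J) (c : Fin 2 → ℝ)
    {h : ℝ → ℝ} (hm : Measurable h) (hb : ∃ C, ∀ s ∈ Set.Icc 0 T, |h s| ≤ C) :
    IsDominated T (totalMark T τ ξ) 1 (markSum τ ε ξ c h) := by
  obtain ⟨D, hD, hle⟩ := hN.exists_abs_weight_le c hb
  refine ⟨hN.measurable_markSum c hm, D, hD, fun s hs ω => ?_⟩
  have := abs_pointSum_le (hN.strictMono ω) (hN.locallyFinite ω) hs.2 (hle ω)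
  rw [pointSum_const_mul_mark] at this
  rw [markSum]
  linarith

lemma isDominated_leftSum
    (hN : IsMarkedHawkes P ℱ T (expBaseline μ₀ κ) (expKernel α β) τ ε ξ J) (c : Fin 2 → ℝ)
    {h : ℝ → ℝ} (hm : Measurable h) (hb : ∃ C, ∀ s ∈ Set.Icc 0 T, |h s| ≤ C) :
    IsDominated T (totalMark T τ ξ) 1 fun s ω =>
      leftSum (fun n => (τ n ω : ℝ)) (weight τ ε ξ c h ω) (s.toNNReal : ℝ) := by
  obtain ⟨D, hD, hle⟩ := hN.exists_abs_weight_le c hb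
  refine IsDominated.comp_toNNReal
    (F := fun s ω => leftSum (fun n => (τ n ω : ℝ)) (weight τ ε ξ c h ω) s)
    ⟨hN.measurable_leftSum (hN.measurable_weight c hm), D, hD, fun s hs ω => ?_⟩
  have := abs_leftSum_le (hN.strictMono ω) (hN.locallyFinite ω) hs.2 (hle ω)
  rw [pointSum_const_mul_mark] at this
  linarith

lemma integral_mark {μ : ℝ → ℝ} {φ : ℝ → Matrix (Fin 2) (Fin 2) ℝ}
    (hN : IsMarkedHawkes P ℱ T μ φ τ ε ξ J) : ∫ ω, ξ 0 ω ∂P = ∫ ω, J ω ∂P :=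
  (hN.mark_identDistrib 0).integral_eq

lemma integral_mark_sq {μ : ℝ → ℝ} {φ : ℝ → Matrix (Fin 2) (Fin 2) ℝ}
    (hN : IsMarkedHawkes P ℱ T μ φ τ ε ξ J) : ∫ ω, ξ 0 ω ^ 2 ∂P = ∫ ω, J ω ^ 2 ∂P :=
  ((hN.mark_identDistrib 0).comp (u := fun x => x ^ 2) (by fun_prop)).integral_eq

variable [IsProbabilityMeasure P]

lemma measurable_predictable_comp_fst {h : ℝ → ℝ} (hm : Measurable h) :
    Measurable[ℱ.predictable] fun q : ℝ≥0 × Ω => h q.1 :=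
  hm.comp (measurable_coe_nnreal_real.comp measurable_predictable_fst)

lemma integral_markSum
    (hN : IsMarkedHawkes P ℱ T (expBaseline μ₀ κ) (expKernel α β) τ ε ξ J) (hT : 0 < T)
    (hμ₀ : 0 < μ₀) (hκ : 0 < κ) (hα : 0 < α) (hβ : 0 < β) (c : Fin 2 → ℝ)
    {h : ℝ → ℝ} (hm : Measurable h) (hb : ∃ C, ∀ s ∈ Set.Icc 0 T, |h s| ≤ C)
    {t : ℝ} (ht : t ∈ Set.Icc 0 T) :
    ∫ ω, markSum τ ε ξ c h t ω ∂P = (∫ ω, J ω ∂P) *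
      ∫ s in 0..t, h s * ∫ ω, combIntensity T μ₀ κ α β τ ε ξ c s ω ∂P := by
  have hL := hN.memLp_totalMark hT hμ₀ hκ hα hβ
  have hd : IsDominated T (totalMark T τ ξ) 1 fun s (_ : Ω) => h s :=
    (IsDominated.of_bounded hm hb).mono hN.totalMark_nonneg zero_le_one
  have hd' : IsDominated T (totalMark T τ ξ) 1 fun s (_ : Ω) => h (s.toNNReal : ℝ) :=
    hd.comp_toNNReal
  have h1 := (hN.integral_pointSum_eq hT hμ₀ hκ hα hβ c
    (Z := fun q => h q.1) (measurable_predictable_comp_fst hm) hd' (g := fun x => x) measurable_id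
    (fun x hx => hx) ((hN.memLp_mark 0).integrable (by norm_num)) ht).2
  have h2 : ∀ ω, markSum τ ε ξ c h t ω = pointSum (fun n => (τ n ω : ℝ))
      (fun n => c (ε n ω) * (h (τ n ω) * ξ n ω)) t := fun ω => by
    rw [markSum]
    congr 1
    ext n
    rw [weight]; ring
  simp only [h2]
  rw [h1, hN.integral_mark,
    (hd'.mul (hN.isDominated_combIntensity hT hμ₀ hκ hα hβ c)).integral_swap hL ht]
  congr 1
  refine intervalIntegral.integral_congr fun s hs => ?_
  rw [Set.uIcc_of_le ht.1] at hs
  simp only [Real.coe_toNNReal _ hs.1]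
  exact integral_const_mul _ _

/-- The compensator formula for the integrand `k(s) X_{s-}`, where `X` is a sum over arrivals. -/
lemma integral_pointSum_leftSum
    (hN : IsMarkedHawkes P ℱ T (expBaseline μ₀ κ) (expKernel α β) τ ε ξ J) (hT : 0 < T)
    (hμ₀ : 0 < μ₀) (hκ : 0 < κ) (hα : 0 < α) (hβ : 0 < β) (c d : Fin 2 → ℝ)
    {h k : ℝ → ℝ} (hm : Measurable h) (hb : ∃ C, ∀ s ∈ Set.Icc 0 T, |h s| ≤ C)
    (km : Measurable k) (kb : ∃ C, ∀ s ∈ Set.Icc 0 T, |k s| ≤ C)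
    {t : ℝ} (ht : t ∈ Set.Icc 0 T) :
    Integrable (fun ω => pointSum (fun n => (τ n ω : ℝ)) (fun n =>
        leftSum (fun n => (τ n ω : ℝ)) (weight τ ε ξ c h ω) (τ n ω) * weight τ ε ξ d k ω n) t) P ∧
      ∫ ω, pointSum (fun n => (τ n ω : ℝ)) (fun n =>
        leftSum (fun n => (τ n ω : ℝ)) (weight τ ε ξ c h ω) (τ n ω) * weight τ ε ξ d k ω n) t ∂P =
      (∫ ω, J ω ∂P) * ∫ s in 0..t, k s *
        ∫ ω, markSum τ ε ξ c h s ω * combIntensity T μ₀ κ α β τ ε ξ d s ω ∂P := by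
  have hL := hN.memLp_totalMark hT hμ₀ hκ hα hβ
  have hd : IsDominated T (totalMark T τ ξ) 0 fun s (_ : Ω) => k s := IsDominated.of_bounded km kb
  have hd' : IsDominated T (totalMark T τ ξ) 0 fun s (_ : Ω) => k (s.toNNReal : ℝ) :=
    hd.comp_toNNReal
  have hZ : Measurable[ℱ.predictable] fun q : ℝ≥0 × Ω => k q.1 *
      leftSum (fun n => (τ n q.2 : ℝ)) (weight τ ε ξ c h q.2) q.1 := by
    have h1 := measurable_predictable_leftSum hN.isStoppingTime (hN.measurable_weight' c hm)
    have h2 := measurable_predictable_comp_fst (ℱ := ℱ) km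
    let : MeasurableSpace (ℝ≥0 × Ω) := ℱ.predictable
    exact h2.mul h1
  have hdom := hd'.mul (hN.isDominated_leftSum c hm hb)
  have h1 := hN.integral_pointSum_eq hT hμ₀ hκ hα hβ d hZ hdom (g := fun x => x) measurable_id
    (fun x hx => hx) ((hN.memLp_mark 0).integrable (by norm_num)) ht
  have h2 : ∀ ω, (fun n => leftSum (fun n => (τ n ω : ℝ)) (weight τ ε ξ c h ω) (τ n ω) *
      weight τ ε ξ d k ω n) = fun n => d (ε n ω) * (k (τ n ω) *
        leftSum (fun n => (τ n ω : ℝ)) (weight τ ε ξ c h ω) (τ n ω) * ξ n ω) := fun ω => by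
    ext n
    simp only [weight]
    ring
  simp only [h2]
  refine ⟨h1.1, ?_⟩
  rw [h1.2, hN.integral_mark]
  congr 1
  have hdom2 := (hd.mul (hN.isDominated_markSum c hm hb)).mul
    (hN.isDominated_combIntensity hT hμ₀ hκ hα hβ d)
  have h3 : ∀ ω, ∫ s in 0..t, k (s.toNNReal : ℝ) *
        leftSum (fun n => (τ n ω : ℝ)) (weight τ ε ξ c h ω) (s.toNNReal : ℝ) *
          combIntensity T μ₀ κ α β τ ε ξ d s ω =
      ∫ s in 0..t, k s * markSum τ ε ξ c h s ω * combIntensity T μ₀ κ α β τ ε ξ d s ω := by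
    intro ω
    -- The predictable integrand contains X_{s-}; replacing it by X_s changes the integrand on a
    -- countable set of times only.
    refine intervalIntegral.integral_congr_ae ?_
    filter_upwards [ae_leftSum_eq_pointSum fun n => (τ n ω : ℝ)] with s hs hs'
    rw [Set.uIoc_of_le ht.1] at hs'
    rw [Real.coe_toNNReal _ hs'.1.le, hs, markSum]
  simp only [h3]
  rw [hdom2.integral_swap hL ht]
  simp only [mul_assoc, integral_const_mul]

/-- Mixed second moments of two sums over the arrivals. -/
lemma integral_markSum_mul_markSum
    (hN : IsMarkedHawkes P ℱ T (expBaseline μ₀ κ) (expKernel α β) τ ε ξ J) (hT : 0 < T)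
    (hμ₀ : 0 < μ₀) (hκ : 0 < κ) (hα : 0 < α) (hβ : 0 < β) (c d : Fin 2 → ℝ)
    {h k : ℝ → ℝ} (hm : Measurable h) (hb : ∃ C, ∀ s ∈ Set.Icc 0 T, |h s| ≤ C)
    (km : Measurable k) (kb : ∃ C, ∀ s ∈ Set.Icc 0 T, |k s| ≤ C)
    {t : ℝ} (ht : t ∈ Set.Icc 0 T) :
    ∫ ω, markSum τ ε ξ c h t ω * markSum τ ε ξ d k t ω ∂P =
      (∫ ω, J ω ∂P) * (∫ s in 0..t, k s *
        ∫ ω, markSum τ ε ξ c h s ω * combIntensity T μ₀ κ α β τ ε ξ d s ω ∂P) +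
      (∫ ω, J ω ∂P) * (∫ s in 0..t, h s *
        ∫ ω, markSum τ ε ξ d k s ω * combIntensity T μ₀ κ α β τ ε ξ c s ω ∂P) +
      (∫ ω, J ω ^ 2 ∂P) * (∫ s in 0..t, h s * k s *
        ∫ ω, combIntensity T μ₀ κ α β τ ε ξ (c * d) s ω ∂P) := by
  have hL := hN.memLp_totalMark hT hμ₀ hκ hα hβ
  have h1 := hN.integral_pointSum_leftSum hT hμ₀ hκ hα hβ c d hm hb km kb ht
  have h2 := hN.integral_pointSum_leftSum hT hμ₀ hκ hα hβ d c km kb hm hb ht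
  have hd : IsDominated T (totalMark T τ ξ) 1 fun s (_ : Ω) => h s * k s :=
    ((IsDominated.of_bounded hm hb).mul (IsDominated.of_bounded km kb)).mono
      hN.totalMark_nonneg (by norm_num)
  have hd' : IsDominated T (totalMark T τ ξ) 1
      fun s (_ : Ω) => h (s.toNNReal : ℝ) * k (s.toNNReal : ℝ) :=
    hd.comp_toNNReal
  have h3 := hN.integral_pointSum_eq hT hμ₀ hκ hα hβ (c * d)
    (Z := fun q => h q.1 * k q.1) (measurable_predictable_comp_fst (hm.mul km)) hd'
    (g := fun x => x ^ 2) (by fun_prop)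
    (fun x _ => sq_nonneg x) (hN.memLp_mark 0).integrable_sq ht
  have hsum : ∀ ω, markSum τ ε ξ c h t ω * markSum τ ε ξ d k t ω =
      pointSum (fun n => (τ n ω : ℝ)) (fun n =>
        leftSum (fun n => (τ n ω : ℝ)) (weight τ ε ξ c h ω) (τ n ω) * weight τ ε ξ d k ω n) t +
      pointSum (fun n => (τ n ω : ℝ)) (fun n =>
        leftSum (fun n => (τ n ω : ℝ)) (weight τ ε ξ d k ω) (τ n ω) * weight τ ε ξ c h ω n) t +
      pointSum (fun n => (τ n ω : ℝ)) (fun n =>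
        (c * d) (ε n ω) * (h (τ n ω) * k (τ n ω) * ξ n ω ^ 2)) t := by
    intro ω
    rw [markSum, markSum, pointSum_mul_pointSum (hN.strictMono ω) (hN.locallyFinite ω) ht.2,
      pointSum_add (hN.strictMono ω) (hN.locallyFinite ω) ht.2,
      pointSum_add (hN.strictMono ω) (hN.locallyFinite ω) ht.2]
    congr 2
    ext n
    simp only [weight, Pi.mul_apply]
    ring
  simp only [hsum]
  have h12 := h1.1.add h2.1
  simp only [Pi.add_def] at h12
  rw [integral_add h12 h3.1, integral_add h1.1 h2.1, h1.2, h2.2, h3.2, hN.integral_mark_sq,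
    (hd'.mul (hN.isDominated_combIntensity hT hμ₀ hκ hα hβ _)).integral_swap hL ht]
  congr 2
  refine intervalIntegral.integral_congr fun s hs => ?_
  rw [Set.uIcc_of_le ht.1] at hs
  simp only [Real.coe_toNNReal _ hs.1]
  exact integral_const_mul _ _

end IsMarkedHawkes

/-! ### The linear differential equations of the moments -/

lemma hasDerivAt_exp_const_mul (r t : ℝ) :
    HasDerivAt (fun t => Real.exp (r * t)) (r * Real.exp (r * t)) t := by
  simpa [mul_comm] using ((hasDerivAt_id t).const_mul r).exp

lemma meanIntensity_eq (T μ₀ κ α β m t : ℝ) :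
    meanIntensity T μ₀ κ α β m t =
      μ₀ * ((β + κ / T) / (β - α * m + κ / T)) * Real.exp (κ / T * t) +
        α * m * (-μ₀ / (β - α * m + κ / T)) * Real.exp (-(β - α * m) * t) := by
  rw [meanIntensity, show κ * (t / T) = κ / T * t by ring]
  ring

lemma continuous_meanIntensity (T μ₀ κ α β m : ℝ) : Continuous (meanIntensity T μ₀ κ α β m) := by
  unfold meanIntensity
  fun_prop

/-- Here y is the candidate for E(S), with S the sum of ξ e^{βτ} over both types: total excitation
at rate αm, forced by the baseline. The last clause turns it into the mean total intensity. -/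
lemma exists_meanSum {T μ₀ κ α β m : ℝ} (hT : 0 < T) (hκ : 0 < κ) (hαβ : α * m < β) :
    ∃ y : ℝ → ℝ, y 0 = 0 ∧
      (∀ t, HasDerivAt y (α * m * y t +
        2 * m * (μ₀ * (Real.exp (β * t) * Real.exp (κ * (t / T))))) t) ∧
      ∀ t, 2 * (μ₀ * Real.exp (κ * (t / T))) + α * (Real.exp (-β * t) * y t) =
        2 * meanIntensity T μ₀ κ α β m t := by
  have hc : 0 < κ / T := by positivity
  have hne : β - α * m + κ / T ≠ 0 := by linarith
  have hexp : ∀ t, Real.exp (κ * (t / T)) = Real.exp (κ / T * t) := fun t => by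
    congr 1; ring
  simp only [meanIntensity_eq, hexp]
  clear hexp
  generalize κ / T = c at *
  refine ⟨fun t => 2 * μ₀ * m / (β - α * m + c) *
    (Real.exp ((β + c) * t) - Real.exp (α * m * t)), by simp, fun t => ?_, fun t => ?_⟩
  · refine (((hasDerivAt_exp_const_mul (β + c) t).sub
      (hasDerivAt_exp_const_mul (α * m) t)).const_mul _).congr_deriv ?_
    rw [← Real.exp_add, ← add_mul]
    have e : (β - α * m + c) * (2 * μ₀ * m / (β - α * m + c)) = 2 * μ₀ * m :=
      mul_div_cancel₀ _ hne
    linear_combination Real.exp ((β + c) * t) * e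
  · have h1 : Real.exp (-β * t) * Real.exp ((β + c) * t) = Real.exp (c * t) := by
      rw [← Real.exp_add]; congr 1; ring
    have h2 : Real.exp (-β * t) * Real.exp (α * m * t) = Real.exp (-(β - α * m) * t) := by
      rw [← Real.exp_add]; congr 1; ring
    rw [mul_left_comm (Real.exp (-β * t)), mul_sub (Real.exp (-β * t)), h1, h2]
    field_simp
    ring

/-- Here q and p are the candidates for E(Y²) and E(XY), and the last clause is the equation for
E(f²). The system is triangular with exponential forcing, so the coefficients are found by comparing
exponentials. -/
lemma exists_second_moments {T μ₀ κ α β m m₂ f₀ : ℝ} (hT : 0 < T) (hκ : 0 < κ) (hα : 0 < α)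
    (hβ : 0 < β) (hm : 0 ≤ m) (hαβ : α * m < β) :
    ∃ q p : ℝ → ℝ, q 0 = 0 ∧ p 0 = 0 ∧
      (∀ t, HasDerivAt q (-(2 * (α * m)) * q t +
        2 * m₂ * (Real.exp (β * t) * Real.exp (β * t) * meanIntensity T μ₀ κ α β m t)) t) ∧
      (∀ t, HasDerivAt p (-(α * m) * p t + (-(α * m) * (Real.exp (-β * t) * q t) +
        2 * m₂ * (Real.exp (β * t) * meanIntensity T μ₀ κ α β m t))) t) ∧
      ∀ t, HasDerivAt (secondMoment T μ₀ κ α β m m₂ f₀)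
        (-(2 * (α * m)) * (Real.exp (-β * t) * p t) +
          2 * m₂ * meanIntensity T μ₀ κ α β m t) t := by
  have hk : 0 ≤ α * m := by positivity
  have hc : 0 < κ / T := by positivity
  have hma := meanIntensity_eq T μ₀ κ α β m
  have hsm : secondMoment T μ₀ κ α β m m₂ f₀ = fun t => f₀ ^ 2 + 2 * μ₀ * m₂ *
    ((C₁ T κ α β m + C₂ T κ α β m + C₃ T κ α β m + C₄ T κ α β m) * Real.exp (κ / T * t)
      - C₁ T κ α β m * Real.exp (-(β - α * m) * t)
      - C₂ T κ α β m * Real.exp (-2 * (β + α * m) * t)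
      - C₃ T κ α β m * Real.exp (-(β + α * m) * t)
      - C₄ T κ α β m) := by
    ext t
    rw [secondMoment, show κ * (t / T) = κ / T * t by ring]
  have hC1 : C₁ T κ α β m = -(α * m) ^ 2 /
      ((β - α * m) * (β + 3 * (α * m)) * (β - α * m + κ / T)) := by rw [C₁]; ring
  have hC2 : C₂ T κ α β m = (α * m) ^ 2 * (β + 2 * (α * m)) /
    ((β + α * m) ^ 2 * (β + 3 * (α * m)) * (2 * β + 2 * (α * m) + κ / T)) := by rw [C₂]; ring
  have hC3 : C₃ T κ α β m = (α * m) * β /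
    ((β + α * m) ^ 2 * (β + α * m + κ / T)) := by rw [C₃]; ring
  have hC4 : C₄ T κ α β m = β ^ 3 / (κ / T * (β + α * m) ^ 2 * (β - α * m)) := rfl
  generalize C₁ T κ α β m = C1 at *
  generalize C₂ T κ α β m = C2 at *
  generalize C₃ T κ α β m = C3 at *
  generalize C₄ T κ α β m = C4 at *
  rw [hsm]
  simp only [hma]
  clear hma hsm
  generalize α * m = k at *
  generalize κ / T = c at *
  have n1 : β - k ≠ 0 := by linarith
  have n2 : β - k + c ≠ 0 := by linarith
  have n3 : β + 3 * k ≠ 0 := by linarith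
  have n4 : β + k ≠ 0 := by linarith
  have n5 : β + k + c ≠ 0 := by linarith
  have n6 : 2 * β + 2 * k + c ≠ 0 := by linarith
  have n7 := hc.ne'
  -- With k = αm and c = κ/T, the mean intensity is A e^{ct} + kB e^{-(β-k)t}. The factor k is kept
  -- out of B because determining R2 requires dividing by k, which may be 0 here.
  obtain ⟨A, hA⟩ : ∃ A, A = μ₀ * ((β + c) / (β - k + c)) := ⟨_, rfl⟩
  obtain ⟨B, hB⟩ : ∃ B, B = -μ₀ / (β - k + c) := ⟨_, rfl⟩
  -- Q1, Q2 are the coefficients of the particular solution for q, and R1, R2, R3 those for p; the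
  -- remaining homogeneous terms are fixed by the value 0 at time 0.
  obtain ⟨Q1, hQ1⟩ : ∃ x, x = 2 * m₂ * A / (2 * β + 2 * k + c) := ⟨_, rfl⟩
  obtain ⟨Q2, hQ2⟩ : ∃ x, x = 2 * m₂ * (k * B) / (β + 3 * k) := ⟨_, rfl⟩
  obtain ⟨R1, hR1⟩ : ∃ x, x = (-k * Q1 + 2 * m₂ * A) / (β + k + c) := ⟨_, rfl⟩
  obtain ⟨R2, hR2⟩ : ∃ x, x = (-Q2 + 2 * m₂ * B) / 2 := ⟨_, rfl⟩
  obtain ⟨R3, hR3⟩ : ∃ x, x = -k * (Q1 + Q2) / (β + k) := ⟨_, rfl⟩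
  have e1 : (2 * β + 2 * k + c) * Q1 = 2 * m₂ * A := by rw [hQ1]; field_simp
  have e2 : (β + 3 * k) * Q2 = 2 * m₂ * (k * B) := by rw [hQ2]; field_simp
  have e3 : (β + k + c) * R1 = -k * Q1 + 2 * m₂ * A := by rw [hR1]; field_simp
  have e4 : 2 * R2 = -Q2 + 2 * m₂ * B := by rw [hR2]; field_simp
  have e5 : (β + k) * R3 = -k * (Q1 + Q2) := by rw [hR3]; field_simp
  -- The identities f1 to f4 compare the coefficients of the four exponentials in the derivative of
  -- the second moment; this is where the closed forms of the constants are checked.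
  have f1 : (2 * μ₀ * m₂) * (C1 * (β - k)) = -(2 * k) * R2 + 2 * m₂ * (k * B) := by
    rw [hR2, hQ2, hB, hC1]; field_simp; ring
  have f2 : (2 * μ₀ * m₂) * (C2 * (2 * (β + k))) = -(2 * k) * R3 := by
    rw [hR3, hQ1, hQ2, hA, hB, hC2]; field_simp; ring
  have f3 : (2 * μ₀ * m₂) * (C3 * (β + k)) = (2 * k) * (R1 + R2 + R3) := by
    rw [hR1, hR2, hR3, hQ1, hQ2, hA, hB, hC3]; field_simp; ring
  have f4 : (2 * μ₀ * m₂) * ((C1 + C2 + C3 + C4) * c) = -(2 * k) * R1 + 2 * m₂ * A := by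
    rw [hR1, hQ1, hA, hC1, hC2, hC3, hC4]; field_simp; ring
  have hx : ∀ a b d t : ℝ, a + b = d →
      Real.exp (a * t) * Real.exp (b * t) = Real.exp (d * t) := fun a b d t h => by
    rw [← Real.exp_add, ← add_mul, h]
  refine ⟨fun t => Q1 * Real.exp ((2 * β + c) * t) + Q2 * Real.exp ((β + k) * t) -
      (Q1 + Q2) * Real.exp (-(2 * k) * t),
    fun t => R1 * Real.exp ((β + c) * t) + R2 * Real.exp (k * t) +
      R3 * Real.exp (-(β + 2 * k) * t) - (R1 + R2 + R3) * Real.exp (-k * t),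
    by simp, by simp, fun t => ?_, fun t => ?_, fun t => ?_⟩
  · refine ((((hasDerivAt_exp_const_mul _ t).const_mul _).add
      ((hasDerivAt_exp_const_mul _ t).const_mul _)).sub
      ((hasDerivAt_exp_const_mul _ t).const_mul _)).congr_deriv ?_
    rw [← hA, ← hB]
    linear_combination Real.exp ((2 * β + c) * t) * e1 + Real.exp ((β + k) * t) * e2
      - 2 * m₂ * A * (hx β β (2 * β) t (by ring)) * Real.exp (c * t)
      - 2 * m₂ * A * (hx (2 * β) c (2 * β + c) t (by ring))
      - 2 * m₂ * (k * B) * (hx β β (2 * β) t (by ring)) * Real.exp (-(β - k) * t)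
      - 2 * m₂ * (k * B) * (hx (2 * β) (-(β - k)) (β + k) t (by ring))
  · refine (((((hasDerivAt_exp_const_mul _ t).const_mul _).add
      ((hasDerivAt_exp_const_mul _ t).const_mul _)).add
      ((hasDerivAt_exp_const_mul _ t).const_mul _)).sub
      ((hasDerivAt_exp_const_mul _ t).const_mul _)).congr_deriv ?_
    rw [← hA, ← hB]
    linear_combination Real.exp ((β + c) * t) * e3 + k * Real.exp (k * t) * e4
      - Real.exp (-(β + 2 * k) * t) * e5
      + k * Q1 * (hx (-β) (2 * β + c) (β + c) t (by ring))
      + k * Q2 * (hx (-β) (β + k) k t (by ring))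
      - k * (Q1 + Q2) * (hx (-β) (-(2 * k)) (-(β + 2 * k)) t (by ring))
      - 2 * m₂ * A * (hx β c (β + c) t (by ring))
      - 2 * m₂ * (k * B) * (hx β (-(β - k)) k t (by ring))
  · refine ((((((hasDerivAt_exp_const_mul _ t).const_mul _).sub
      ((hasDerivAt_exp_const_mul _ t).const_mul _)).sub
      ((hasDerivAt_exp_const_mul _ t).const_mul _)).sub
      ((hasDerivAt_exp_const_mul _ t).const_mul _)).sub_const _
      |>.const_mul _ |>.const_add _).congr_deriv ?_
    rw [← hA, ← hB]
    linear_combination Real.exp (c * t) * f4 + Real.exp (-(β - k) * t) * f1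
      + Real.exp (-2 * (β + k) * t) * f2 + Real.exp (-(β + k) * t) * f3
      + 2 * k * R1 * (hx (-β) (β + c) c t (by ring))
      + 2 * k * R2 * (hx (-β) k (-(β - k)) t (by ring))
      + 2 * k * R3 * (hx (-β) (-(β + 2 * k)) (-2 * (β + k)) t (by ring))
      - 2 * k * (R1 + R2 + R3) * (hx (-β) (-k) (-(β + k)) t (by ring))

lemma secondMoment_zero (T μ₀ κ α β m m₂ f₀ : ℝ) :
    secondMoment T μ₀ κ α β m m₂ f₀ 0 = f₀ ^ 2 := by
  simp [secondMoment]
  right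
  ring

/-! ### Sum and difference of the two types, and sums restricted to a time window -/

/-- The signs of the jumps. -/
def sgn : Fin 2 → ℝ := ![1, -1]

lemma sgn_mul_sgn : sgn * sgn = 1 := by
  ext i; fin_cases i <;> simp [sgn]

lemma intensity_zero_eq_combIntensity {Ω : Type*} {T μ₀ κ α β : ℝ} {τ : ℕ → Ω → ℝ≥0}
    {ε : ℕ → Ω → Fin 2} {ξ : ℕ → Ω → ℝ} (t : ℝ) (ω : Ω) :
    intensity T (expBaseline μ₀ κ) (expKernel α β) τ ε ξ 0 t ω =
      1 / 2 * (combIntensity T μ₀ κ α β τ ε ξ 1 t ω +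
        combIntensity T μ₀ κ α β τ ε ξ sgn t ω) := by
  rw [combIntensity, combIntensity]
  simp only [sgn, Matrix.cons_val_zero, Matrix.cons_val_one, Pi.one_apply]
  ring

lemma exists_bound_exp (β T : ℝ) : ∃ C, ∀ s ∈ Set.Icc 0 T, |Real.exp (β * s)| ≤ C :=
  isCompact_Icc.exists_bound_of_continuousOn (f := fun s => Real.exp (β * s)) (by fun_prop)

lemma exists_bound_one (T : ℝ) : ∃ C, ∀ s ∈ Set.Icc 0 T, |(fun _ : ℝ => (1 : ℝ)) s| ≤ C :=
  ⟨1, fun _ _ => by simp⟩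

lemma exists_bound_indicator {T : ℝ} {h : ℝ → ℝ} (hb : ∃ C, ∀ s ∈ Set.Icc 0 T, |h s| ≤ C) (A : Set ℝ) :
    ∃ C, ∀ s ∈ Set.Icc 0 T, |A.indicator h s| ≤ C := by
  obtain ⟨C, hC⟩ := hb
  exact ⟨C, fun s hs => (norm_indicator_le_norm_self h s).trans (hC s hs)⟩

/-- A sum stopped at s is again a sum of the same kind at any later time, so the formula for mixed
moments at one time also covers two times. -/
lemma markSum_indicator_Iic {Ω : Type*} {τ : ℕ → Ω → ℝ≥0} {ε : ℕ → Ω → Fin 2}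
    {ξ : ℕ → Ω → ℝ} (c : Fin 2 → ℝ) (h : ℝ → ℝ) {s r : ℝ} (hsr : s ≤ r) (ω : Ω) :
    markSum τ ε ξ c ((Set.Iic s).indicator h) r ω = markSum τ ε ξ c h s ω := by
  refine tsum_congr fun n => ?_
  by_cases hn : (τ n ω : ℝ) ≤ s
  · simp [weight, hn, hn.trans hsr]
  · simp [weight, hn]

lemma markSum_indicator_Ioi_of_le {Ω : Type*} {τ : ℕ → Ω → ℝ≥0} {ε : ℕ → Ω → Fin 2}
    {ξ : ℕ → Ω → ℝ} (c : Fin 2 → ℝ) (h : ℝ → ℝ) {s r : ℝ} (hrs : r ≤ s) (ω : Ω) :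
    markSum τ ε ξ c ((Set.Ioi s).indicator h) r ω = 0 := by
  refine (tsum_congr fun n => ?_).trans tsum_zero
  by_cases hn : (τ n ω : ℝ) ≤ r
  · simp [weight, hn.trans hrs]
  · simp [hn]

namespace IsMarkedHawkes

variable {Ω : Type*} [mΩ : MeasurableSpace Ω] {P : Measure Ω}
  {ℱ : Filtration ℝ≥0 mΩ} {T μ₀ κ α β : ℝ}
  {τ : ℕ → Ω → ℝ≥0} {ε : ℕ → Ω → Fin 2} {ξ : ℕ → Ω → ℝ} {J : Ω → ℝ}

lemma markSum_one_eq
    (hN : IsMarkedHawkes P ℱ T (expBaseline μ₀ κ) (expKernel α β) τ ε ξ J) (h : ℝ → ℝ) {t : ℝ}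
    (htT : t ≤ T) (ω : Ω) : markSum τ ε ξ 1 h t ω =
      markSum τ ε ξ (Pi.single 0 1) h t ω + markSum τ ε ξ (Pi.single 1 1) h t ω := by
  rw [markSum, markSum, markSum, ← pointSum_add (hN.strictMono ω) (hN.locallyFinite ω) htT]
  congr 1
  ext n
  rcases Fin.exists_fin_two.1 ⟨ε n ω, rfl⟩ with h | h <;> simp [weight, h]

lemma markSum_sgn_eq
    (hN : IsMarkedHawkes P ℱ T (expBaseline μ₀ κ) (expKernel α β) τ ε ξ J) (h : ℝ → ℝ) {t : ℝ}
    (htT : t ≤ T) (ω : Ω) : markSum τ ε ξ sgn h t ω =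
      markSum τ ε ξ (Pi.single 0 1) h t ω - markSum τ ε ξ (Pi.single 1 1) h t ω := by
  rw [markSum, markSum, markSum, ← pointSum_sub (hN.strictMono ω) (hN.locallyFinite ω) htT]
  congr 1
  ext n
  rcases Fin.exists_fin_two.1 ⟨ε n ω, rfl⟩ with h | h <;> simp [weight, h, sgn]

lemma price_eq
    (hN : IsMarkedHawkes P ℱ T (expBaseline μ₀ κ) (expKernel α β) τ ε ξ J) (f₀ : ℝ) {t : ℝ}
    (htT : t ≤ T) (ω : Ω) :
    price f₀ τ ε ξ t ω = f₀ + markSum τ ε ξ sgn (fun _ => 1) t ω := by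
  rw [price, jumpSum, jumpSum, markIntegral_eq_markSum, markIntegral_eq_markSum,
    hN.markSum_sgn_eq _ htT]
  ring

lemma combIntensity_one
    (hN : IsMarkedHawkes P ℱ T (expBaseline μ₀ κ) (expKernel α β) τ ε ξ J) {t : ℝ}
    (htT : t ≤ T) (ω : Ω) : combIntensity T μ₀ κ α β τ ε ξ 1 t ω =
      2 * (μ₀ * Real.exp (κ * (t / T))) +
        α * (Real.exp (-β * t) * markSum τ ε ξ 1 (fun s => Real.exp (β * s)) t ω) := by
  rw [combIntensity, intensity_zero_eq, intensity_one_eq, hN.markSum_one_eq _ htT]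
  simp only [Pi.one_apply]
  ring

lemma combIntensity_sgn
    (hN : IsMarkedHawkes P ℱ T (expBaseline μ₀ κ) (expKernel α β) τ ε ξ J) {t : ℝ}
    (htT : t ≤ T) (ω : Ω) : combIntensity T μ₀ κ α β τ ε ξ sgn t ω =
      -α * (Real.exp (-β * t) * markSum τ ε ξ sgn (fun s => Real.exp (β * s)) t ω) := by
  rw [combIntensity, intensity_zero_eq, intensity_one_eq, hN.markSum_sgn_eq _ htT]
  simp only [sgn, Matrix.cons_val_zero, Matrix.cons_val_one]
  ring

lemma markSum_indicator_Ioi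
    (hN : IsMarkedHawkes P ℱ T (expBaseline μ₀ κ) (expKernel α β) τ ε ξ J) (c : Fin 2 → ℝ)
    (h : ℝ → ℝ) {s r : ℝ} (hsr : s ≤ r) (hrT : r ≤ T) (ω : Ω) :
    markSum τ ε ξ c ((Set.Ioi s).indicator h) r ω =
      markSum τ ε ξ c h r ω - markSum τ ε ξ c h s ω := by
  rw [← markSum_indicator_Iic c h hsr ω, markSum, markSum, markSum,
    ← pointSum_sub (hN.strictMono ω) (hN.locallyFinite ω) hrT]
  congr 1
  ext n
  by_cases hn : (τ n ω : ℝ) ≤ s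
  · simp [weight, hn]
  · simp [weight, hn, not_le.1 hn]

/-! ### Moment equations and their solutions -/

variable [IsProbabilityMeasure P]

/-- Cross-excitation reverses the sign: E(Y) has drift -αm E(Y) with no forcing, as the baselines
cancel, and starts from 0. -/
lemma integral_markSum_sgn_exp
    (hN : IsMarkedHawkes P ℱ T (expBaseline μ₀ κ) (expKernel α β) τ ε ξ J) (hT : 0 < T)
    (hμ₀ : 0 < μ₀) (hκ : 0 < κ) (hα : 0 < α) (hβ : 0 < β) {t : ℝ} (ht : t ∈ Set.Icc 0 T) :
    ∫ ω, markSum τ ε ξ sgn (fun s => Real.exp (β * s)) t ω ∂P = 0 := by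
  have hL := hN.memLp_totalMark hT hμ₀ hκ hα hβ
  have hd := (hN.isDominated_markSum sgn (h := fun s => Real.exp (β * s)) (by fun_prop)
    (exists_bound_exp β T)).mono hN.totalMark_nonneg one_le_two
  obtain ⟨C, hC⟩ := hd.exists_bound hL
  refine eqOn_of_integral_eq (A := -(α * ∫ ω, J ω ∂P)) (c := 0) (g := fun _ => 0)
    (z := fun _ => 0) hC (hd.intervalIntegrable hL le_rfl hT.le le_rfl) (fun u hu => ?_)
    (fun u => (hasDerivAt_const u 0).congr_deriv (by simp)) continuous_const rfl t ht
  rw [hN.integral_markSum hT hμ₀ hκ hα hβ sgn (by fun_prop) (exists_bound_exp β T) hu, zero_add,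
    ← intervalIntegral.integral_const_mul]
  refine intervalIntegral.integral_congr fun s hs => ?_
  rw [Set.uIcc_of_le hu.1] at hs
  simp only [hN.combIntensity_sgn (hs.2.trans hu.2), integral_const_mul]
  have : Real.exp (β * s) * Real.exp (-β * s) = 1 := by
    rw [← Real.exp_add]; simp
  linear_combination (-α * (∫ ω, J ω ∂P) *
    ∫ ω, markSum τ ε ξ sgn (fun s => Real.exp (β * s)) s ω ∂P) * this

lemma integral_combIntensity_sgn
    (hN : IsMarkedHawkes P ℱ T (expBaseline μ₀ κ) (expKernel α β) τ ε ξ J) (hT : 0 < T)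
    (hμ₀ : 0 < μ₀) (hκ : 0 < κ) (hα : 0 < α) (hβ : 0 < β) {t : ℝ} (ht : t ∈ Set.Icc 0 T) :
    ∫ ω, combIntensity T μ₀ κ α β τ ε ξ sgn t ω ∂P = 0 := by
  simp only [hN.combIntensity_sgn ht.2, integral_const_mul,
    hN.integral_markSum_sgn_exp hT hμ₀ hκ hα hβ ht, mul_zero]

lemma integral_markSum_sgn
    (hN : IsMarkedHawkes P ℱ T (expBaseline μ₀ κ) (expKernel α β) τ ε ξ J) (hT : 0 < T)
    (hμ₀ : 0 < μ₀) (hκ : 0 < κ) (hα : 0 < α) (hβ : 0 < β) {h : ℝ → ℝ} (hm : Measurable h)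
    (hb : ∃ C, ∀ s ∈ Set.Icc 0 T, |h s| ≤ C) {t : ℝ} (ht : t ∈ Set.Icc 0 T) :
    ∫ ω, markSum τ ε ξ sgn h t ω ∂P = 0 := by
  rw [hN.integral_markSum hT hμ₀ hκ hα hβ sgn hm hb ht, mul_eq_zero]
  right
  rw [intervalIntegral.integral_congr (g := fun _ => 0) fun s hs => ?_]
  · simp
  · rw [Set.uIcc_of_le ht.1] at hs
    simp only [hN.integral_combIntensity_sgn hT hμ₀ hκ hα hβ ⟨hs.1, hs.2.trans ht.2⟩, mul_zero]

/-- Summing the two types turns cross-excitation into self-excitation, giving a closed equation for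
E(S). -/
lemma integral_combIntensity_one
    (hN : IsMarkedHawkes P ℱ T (expBaseline μ₀ κ) (expKernel α β) τ ε ξ J) (hT : 0 < T)
    (hμ₀ : 0 < μ₀) (hκ : 0 < κ) (hα : 0 < α) (hβ : 0 < β) {m : ℝ} (hm : m = ∫ ω, J ω ∂P)
    (hαβ : α * m < β) {t : ℝ} (ht : t ∈ Set.Icc 0 T) :
    ∫ ω, combIntensity T μ₀ κ α β τ ε ξ 1 t ω ∂P = 2 * meanIntensity T μ₀ κ α β m t := by
  have hL := hN.memLp_totalMark hT hμ₀ hκ hα hβ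
  have hd := (hN.isDominated_markSum 1 (h := fun s => Real.exp (β * s)) (by fun_prop)
    (exists_bound_exp β T)).mono hN.totalMark_nonneg one_le_two
  obtain ⟨C, hC⟩ := hd.exists_bound hL
  obtain ⟨y, hy0, hy, hyeq⟩ := exists_meanSum (μ₀ := μ₀) hT hκ hαβ
  have hmean : ∀ s ∈ Set.Icc 0 T, ∫ ω, combIntensity T μ₀ κ α β τ ε ξ 1 s ω ∂P =
      2 * (μ₀ * Real.exp (κ * (s / T))) + α * (Real.exp (-β * s) *
        ∫ ω, markSum τ ε ξ 1 (fun s => Real.exp (β * s)) s ω ∂P) := fun s hs => by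
    simp only [hN.combIntensity_one hs.2]
    rw [integral_add (integrable_const _) (((hd.integrable hL hs).const_mul _).const_mul _),
      integral_const, probReal_univ, one_smul, integral_const_mul, integral_const_mul]
  have key : ∀ u ∈ Set.Icc 0 T,
      ∫ ω, markSum τ ε ξ 1 (fun s => Real.exp (β * s)) u ω ∂P = y u := by
    refine eqOn_of_integral_eq (A := α * m) (c := 0) hC (hd.intervalIntegrable hL le_rfl hT.le le_rfl)
      (fun u hu => ?_) hy (by fun_prop) hy0
    rw [hN.integral_markSum hT hμ₀ hκ hα hβ 1 (by fun_prop) (exists_bound_exp β T) hu, zero_add,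
      ← intervalIntegral.integral_const_mul, ← hm]
    refine intervalIntegral.integral_congr fun s hs => ?_
    rw [Set.uIcc_of_le hu.1] at hs
    simp only [hmean s ⟨hs.1, hs.2.trans hu.2⟩]
    have : Real.exp (β * s) * Real.exp (-β * s) = 1 := by
      rw [← Real.exp_add]; simp
    linear_combination (α * m *
      ∫ ω, markSum τ ε ξ 1 (fun s => Real.exp (β * s)) s ω ∂P) * this
  rw [hmean t ht, key t ht, hyeq]

/-- Mixed second moments of the signed sums over the arrivals. -/
lemma integral_markSum_sgn_mul
    (hN : IsMarkedHawkes P ℱ T (expBaseline μ₀ κ) (expKernel α β) τ ε ξ J) (hT : 0 < T)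
    (hμ₀ : 0 < μ₀) (hκ : 0 < κ) (hα : 0 < α) (hβ : 0 < β) {m m₂ : ℝ} (hm : m = ∫ ω, J ω ∂P)
    (hm₂ : m₂ = ∫ ω, J ω ^ 2 ∂P) (hαβ : α * m < β)
    {h k : ℝ → ℝ} (hhm : Measurable h) (hb : ∃ C, ∀ s ∈ Set.Icc 0 T, |h s| ≤ C)
    (km : Measurable k) (kb : ∃ C, ∀ s ∈ Set.Icc 0 T, |k s| ≤ C)
    {t : ℝ} (ht : t ∈ Set.Icc 0 T) :
    ∫ ω, markSum τ ε ξ sgn h t ω * markSum τ ε ξ sgn k t ω ∂P = ∫ s in 0..t,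
      (-(α * m) * (k s * (Real.exp (-β * s) * ∫ ω, markSum τ ε ξ sgn h s ω *
          markSum τ ε ξ sgn (fun s => Real.exp (β * s)) s ω ∂P)) +
        -(α * m) * (h s * (Real.exp (-β * s) * ∫ ω, markSum τ ε ξ sgn k s ω *
          markSum τ ε ξ sgn (fun s => Real.exp (β * s)) s ω ∂P)) +
        2 * m₂ * (h s * k s * meanIntensity T μ₀ κ α β m s)) := by
  have hL := hN.memLp_totalMark hT hμ₀ hκ hα hβ
  have hii : ∀ {u v : ℝ → ℝ}, Measurable u → (∃ C, ∀ s ∈ Set.Icc 0 T, |u s| ≤ C) →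
      Measurable v → (∃ C, ∀ s ∈ Set.Icc 0 T, |v s| ≤ C) →
      IntervalIntegrable (fun s => u s * ∫ ω, markSum τ ε ξ sgn v s ω *
        combIntensity T μ₀ κ α β τ ε ξ sgn s ω ∂P) volume 0 t := by
    intro u v hu hub hv hvb
    have := ((IsDominated.of_bounded hu hub).mul ((hN.isDominated_markSum sgn hv hvb).mul
      (hN.isDominated_combIntensity hT hμ₀ hκ hα hβ sgn))).intervalIntegrable hL le_rfl ht.1 ht.2
    simpa only [integral_const_mul] using this
  have hi3 : IntervalIntegrable (fun s => h s * k s *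
      ∫ ω, combIntensity T μ₀ κ α β τ ε ξ (sgn * sgn) s ω ∂P) volume 0 t := by
    have := ((((IsDominated.of_bounded hhm hb).mul (IsDominated.of_bounded km kb)).mul
      (hN.isDominated_combIntensity hT hμ₀ hκ hα hβ (sgn * sgn))).mono hN.totalMark_nonneg
        (by norm_num : 0 + 0 + 1 ≤ 2)).intervalIntegrable hL le_rfl ht.1 ht.2
    simpa only [integral_const_mul] using this
  rw [hN.integral_markSum_mul_markSum hT hμ₀ hκ hα hβ sgn sgn hhm hb km kb ht, ← hm, ← hm₂,
    ← intervalIntegral.integral_const_mul, ← intervalIntegral.integral_const_mul,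
    ← intervalIntegral.integral_const_mul,
    ← intervalIntegral.integral_add ((hii km kb hhm hb).const_mul m)
      ((hii hhm hb km kb).const_mul m),
    ← intervalIntegral.integral_add (((hii km kb hhm hb).const_mul m).add
      ((hii hhm hb km kb).const_mul m)) (hi3.const_mul m₂)]
  refine intervalIntegral.integral_congr fun s hs => ?_
  rw [Set.uIcc_of_le ht.1] at hs
  have hs' : s ∈ Set.Icc 0 T := ⟨hs.1, hs.2.trans ht.2⟩
  have hx : ∀ v : ℝ → ℝ, ∫ ω, markSum τ ε ξ sgn v s ω *
      combIntensity T μ₀ κ α β τ ε ξ sgn s ω ∂P = -α * (Real.exp (-β * s) *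
        ∫ ω, markSum τ ε ξ sgn v s ω *
          markSum τ ε ξ sgn (fun s => Real.exp (β * s)) s ω ∂P) := fun v => by
    rw [← integral_const_mul, ← integral_const_mul]
    refine integral_congr_ae (Filter.Eventually.of_forall fun ω => ?_)
    simp only [hN.combIntensity_sgn hs'.2]
    ring
  simp only [hx, sgn_mul_sgn, hN.integral_combIntensity_one hT hμ₀ hκ hα hβ hm hαβ hs']
  ring

/-- Closed forms of the second moments of the signed sums over the arrivals. -/
lemma exists_integral_markSum_sgn_mul
    (hN : IsMarkedHawkes P ℱ T (expBaseline μ₀ κ) (expKernel α β) τ ε ξ J) (hT : 0 < T)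
    (hμ₀ : 0 < μ₀) (hκ : 0 < κ) (hα : 0 < α) (hβ : 0 < β) {m m₂ : ℝ} (hm : m = ∫ ω, J ω ∂P)
    (hm₂ : m₂ = ∫ ω, J ω ^ 2 ∂P) (hαβ : α * m < β) (f₀ : ℝ) :
    ∃ p : ℝ → ℝ,
      (∀ t ∈ Set.Icc 0 T, ∫ ω, markSum τ ε ξ sgn (fun _ => 1) t ω *
        markSum τ ε ξ sgn (fun s => Real.exp (β * s)) t ω ∂P = p t) ∧
      (∀ t ∈ Set.Icc 0 T, ∫ ω, markSum τ ε ξ sgn (fun _ => 1) t ω *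
        markSum τ ε ξ sgn (fun _ => 1) t ω ∂P =
          secondMoment T μ₀ κ α β m m₂ f₀ t - f₀ ^ 2) ∧
      ∀ t, HasDerivAt (secondMoment T μ₀ κ α β m m₂ f₀)
        (-(2 * (α * m)) * (Real.exp (-β * t) * p t) +
          2 * m₂ * meanIntensity T μ₀ κ α β m t) t := by
  have hL := hN.memLp_totalMark hT hμ₀ hκ hα hβ
  have hm0 : 0 ≤ m := hm ▸ hN.integral_mark_nonneg
  obtain ⟨q, p, hq0, hp0, hq, hp, hr⟩ := exists_second_moments (μ₀ := μ₀) (m₂ := m₂) (f₀ := f₀)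
    hT hκ hα hβ hm0 hαβ
  have hqc : Continuous q := continuous_iff_continuousAt.2 fun t => (hq t).continuousAt
  have hpc : Continuous p := continuous_iff_continuousAt.2 fun t => (hp t).continuousAt
  have hac := continuous_meanIntensity T μ₀ κ α β m
  have hem : Measurable fun s => Real.exp (β * s) := by fun_prop
  have hde := hN.isDominated_markSum sgn hem (exists_bound_exp β T)
  have hd1 := hN.isDominated_markSum sgn measurable_const (exists_bound_one T)
  have hexp : ∀ s, Real.exp (β * s) * Real.exp (-β * s) = 1 := fun s => by
    rw [← Real.exp_add]; simp
  -- With both weights equal to e^{βs}, the moment identity is a closed equation for E(Y²).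
  have hqeq : ∀ t ∈ Set.Icc 0 T, ∫ ω, markSum τ ε ξ sgn (fun s => Real.exp (β * s)) t ω *
      markSum τ ε ξ sgn (fun s => Real.exp (β * s)) t ω ∂P = q t := by
    obtain ⟨C, hC⟩ := (hde.mul hde).exists_bound hL
    refine eqOn_of_integral_eq (A := -(2 * (α * m))) (c := 0) hC
      ((hde.mul hde).intervalIntegrable hL le_rfl hT.le le_rfl) (fun u hu => ?_) hq
      (by fun_prop) hq0
    rw [hN.integral_markSum_sgn_mul hT hμ₀ hκ hα hβ hm hm₂ hαβ hem (exists_bound_exp β T) hem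
      (exists_bound_exp β T) hu, zero_add]
    refine intervalIntegral.integral_congr fun s _ => ?_
    linear_combination (-(2 * (α * m)) *
      ∫ ω, markSum τ ε ξ sgn (fun s => Real.exp (β * s)) s ω *
        markSum τ ε ξ sgn (fun s => Real.exp (β * s)) s ω ∂P) * hexp s
  -- With weights 1 and e^{βs}, one drift term is E(XY) itself and the other is the E(Y²) just
  -- found.
  have hpeq : ∀ t ∈ Set.Icc 0 T, ∫ ω, markSum τ ε ξ sgn (fun _ => 1) t ω *
      markSum τ ε ξ sgn (fun s => Real.exp (β * s)) t ω ∂P = p t := by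
    obtain ⟨C, hC⟩ := (hd1.mul hde).exists_bound hL
    refine eqOn_of_integral_eq (A := -(α * m)) (c := 0) hC
      ((hd1.mul hde).intervalIntegrable hL le_rfl hT.le le_rfl) (fun u hu => ?_) hp
      (by fun_prop) hp0
    rw [hN.integral_markSum_sgn_mul hT hμ₀ hκ hα hβ hm hm₂ hαβ measurable_const
      (exists_bound_one T) hem (exists_bound_exp β T) hu, zero_add]
    refine intervalIntegral.integral_congr fun s hs => ?_
    rw [Set.uIcc_of_le hu.1] at hs
    simp only [hqeq s ⟨hs.1, hs.2.trans hu.2⟩]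
    linear_combination (-(α * m) *
      ∫ ω, markSum τ ε ξ sgn (fun _ => 1) s ω *
        markSum τ ε ξ sgn (fun s => Real.exp (β * s)) s ω ∂P) * hexp s
  refine ⟨p, hpeq, fun t ht => ?_, hr⟩
  rw [hN.integral_markSum_sgn_mul hT hμ₀ hκ hα hβ hm hm₂ hαβ measurable_const
      (exists_bound_one T) measurable_const (exists_bound_one T) ht]
  have hint : IntervalIntegrable (fun t => -(2 * (α * m)) * (Real.exp (-β * t) * p t) +
      2 * m₂ * meanIntensity T μ₀ κ α β m t) volume 0 t :=
    Continuous.intervalIntegrable (by fun_prop) _ _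
  rw [← secondMoment_zero T μ₀ κ α β m m₂ f₀,
    ← intervalIntegral.integral_eq_sub_of_hasDerivAt (fun s _ => hr s) hint]
  refine intervalIntegral.integral_congr fun s hs => ?_
  rw [Set.uIcc_of_le ht.1] at hs
  simp only [hpeq s ⟨hs.1, hs.2.trans ht.2⟩]
  ring

/-! ### Increments -/

/-- X_s and the increment over (s, v] are sums at time v with weights cut off to {≤ s} and {> s}.
The disjoint supports kill the squared-jump term and one of the two drift terms; the other lives on
(s, v] only. -/
lemma integral_markSum_mul_increment
    (hN : IsMarkedHawkes P ℱ T (expBaseline μ₀ κ) (expKernel α β) τ ε ξ J) (hT : 0 < T)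
    (hμ₀ : 0 < μ₀) (hκ : 0 < κ) (hα : 0 < α) (hβ : 0 < β) {m : ℝ} (hm : m = ∫ ω, J ω ∂P)
    (hαβ : α * m < β) {k : ℝ → ℝ}
    (km : Measurable k) (kb : ∃ C, ∀ s ∈ Set.Icc 0 T, |k s| ≤ C)
    {s v : ℝ} (hs : 0 ≤ s) (hsv : s ≤ v) (hv : v ≤ T) :
    ∫ ω, markSum τ ε ξ sgn (fun _ => 1) s ω *
        (markSum τ ε ξ sgn k v ω - markSum τ ε ξ sgn k s ω) ∂P =
      ∫ r in s..v, -(α * m) * (k r * (Real.exp (-β * r) *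
        ∫ ω, markSum τ ε ξ sgn (fun _ => 1) s ω *
          markSum τ ε ξ sgn (fun s => Real.exp (β * s)) r ω ∂P)) := by
  have h1 := hN.integral_markSum_sgn_mul hT hμ₀ hκ hα hβ hm rfl hαβ
    (h := (Set.Iic s).indicator fun _ => 1) (k := (Set.Ioi s).indicator k)
    (measurable_const.indicator measurableSet_Iic)
    (exists_bound_indicator (exists_bound_one T) _) (km.indicator measurableSet_Ioi)
    (exists_bound_indicator kb _) ⟨hs.trans hsv, hv⟩
  simp only [markSum_indicator_Iic sgn (fun _ => 1) hsv,
    hN.markSum_indicator_Ioi sgn k hsv hv] at h1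
  rw [h1, intervalIntegral.integral_of_le (hs.trans hsv), intervalIntegral.integral_of_le hsv]
  rw [setIntegral_eq_of_subset_of_forall_sdiff_eq_zero measurableSet_Ioc
    (Set.Ioc_subset_Ioc_left hs) fun r hr => ?_]
  · refine setIntegral_congr_fun measurableSet_Ioc fun r hr => ?_
    simp [markSum_indicator_Iic sgn (fun _ => 1) hr.1.le, hr.1, not_le.2 hr.1]
  · have hrs : r ≤ s := by
      by_contra! h
      exact hr.2 ⟨h, hr.1.2⟩
    simp [markSum_indicator_Ioi_of_le sgn k hrs, not_lt.2 hrs]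

/-- The correlation between the process and its later increments. -/
lemma integral_markSum_mul_increment_one
    (hN : IsMarkedHawkes P ℱ T (expBaseline μ₀ κ) (expKernel α β) τ ε ξ J) (hT : 0 < T)
    (hμ₀ : 0 < μ₀) (hκ : 0 < κ) (hα : 0 < α) (hβ : 0 < β) {m : ℝ} (hm : m = ∫ ω, J ω ∂P)
    (hαβ : α * m < β) {s t : ℝ} (hs : 0 ≤ s) (hst : s ≤ t) (ht : t ≤ T) :
    ∫ ω, markSum τ ε ξ sgn (fun _ => 1) s ω *
        (markSum τ ε ξ sgn (fun _ => 1) t ω - markSum τ ε ξ sgn (fun _ => 1) s ω) ∂P =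
      -(α * m) * (Real.exp (-β * s) * ∫ ω, markSum τ ε ξ sgn (fun _ => 1) s ω *
          markSum τ ε ξ sgn (fun s => Real.exp (β * s)) s ω ∂P) *
        ((1 - Real.exp (-(β + α * m) * (t - s))) / (β + α * m)) := by
  have hL := hN.memLp_totalMark hT hμ₀ hκ hα hβ
  have hm0 : 0 ≤ m := hm ▸ hN.integral_mark_nonneg
  have hsT : s ∈ Set.Icc 0 T := ⟨hs, hst.trans ht⟩
  have hem : Measurable fun s => Real.exp (β * s) := by fun_prop
  have hde := hN.isDominated_markSum sgn hem (exists_bound_exp β T)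
  have hd1 := hN.isDominated_markSum sgn measurable_const (exists_bound_one T)
  have hd := (hd1.freeze hsT).mul hde
  obtain ⟨C, hC⟩ := hd.exists_bound hL
  set N : ℝ → ℝ := fun v => ∫ ω, markSum τ ε ξ sgn (fun _ => 1) s ω *
    markSum τ ε ξ sgn (fun s => Real.exp (β * s)) v ω ∂P with hNdef
  -- With weight e^{βr} the increment formula closes up: for v ≥ s, E(X_s Y_v) decays at rate αm.
  have hNeq : ∀ v ∈ Set.Icc s T, N v = N s * Real.exp (-(α * m) * (v - s)) := by
    refine eqOn_of_integral_eq (A := -(α * m)) (c := N s) (g := fun _ => 0)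
      (fun v hv => hC v ⟨hs.trans hv.1, hv.2⟩)
      (hd.intervalIntegrable hL hs hsT.2 le_rfl) (fun v hv => ?_) (fun v => ?_)
      continuous_const (by simp)
    · have h1 := hN.integral_markSum_mul_increment hT hμ₀ hκ hα hβ hm hαβ hem
        (exists_bound_exp β T) hs hv.1 hv.2
      simp only [mul_sub] at h1
      rw [integral_sub (hd.integrable hL ⟨hs.trans hv.1, hv.2⟩) (hd.integrable hL hsT),
        sub_eq_iff_eq_add'] at h1
      refine h1.trans ?_
      congr 1
      refine intervalIntegral.integral_congr fun r _ => ?_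
      have : Real.exp (β * r) * Real.exp (-β * r) = 1 := by
        rw [← Real.exp_add]; simp
      linear_combination (-(α * m) * N r) * this
    · refine ((((hasDerivAt_id v).sub_const s).const_mul (-(α * m))).exp.const_mul
        (N s)).congr_deriv ?_
      simp only [id]
      ring
  rw [hN.integral_markSum_mul_increment hT hμ₀ hκ hα hβ hm hαβ measurable_const
    (exists_bound_one T) hs hst ht]
  have hk : β + α * m ≠ 0 := by positivity
  have hint : ∫ r in s..t, Real.exp (-(β + α * m) * (r - s)) =
      (1 - Real.exp (-(β + α * m) * (t - s))) / (β + α * m) := by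
    rw [intervalIntegral.integral_eq_sub_of_hasDerivAt
      (f := fun r => -Real.exp (-(β + α * m) * (r - s)) / (β + α * m)) (fun r _ => ?_)
      (Continuous.intervalIntegrable (by fun_prop) _ _)]
    · simp only [sub_self, mul_zero, Real.exp_zero]
      ring
    · refine ((((hasDerivAt_id r).sub_const s).const_mul (-(β + α * m))).exp.neg.div_const
        _).congr_deriv ?_
      simp only [id]
      field_simp
  rw [← hint, ← intervalIntegral.integral_const_mul]
  refine intervalIntegral.integral_congr fun r hr => ?_
  rw [Set.uIcc_of_le hst] at hr
  have h2 : N r = _ := hNeq r ⟨hr.1, hr.2.trans ht⟩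
  -- The kernel decay β and the decay αm of the correlation add up to the rate β + αm.
  have h3 : Real.exp (-β * r) * Real.exp (-(α * m) * (r - s)) =
      Real.exp (-β * s) * Real.exp (-(β + α * m) * (r - s)) := by
    rw [← Real.exp_add, ← Real.exp_add]; congr 1; ring
  change -(α * m) * (1 * (Real.exp (-β * r) * N r)) = -(α * m) * (Real.exp (-β * s) * N s) * _
  rw [h2]
  linear_combination (-(α * m) * N s) * h3

end IsMarkedHawkes

end MarkedHawkes

end

/-! ### The signature plot and the final statement -/

/-- Telescoping form of the signature plot. -/
lemma MarkedHawkes.signaturePlot_eq {Ω : Type*} [MeasurableSpace Ω] (P : Measure Ω)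
    (f : ℝ → Ω → ℝ) {t δ : ℝ} {E D : ℝ → ℝ} {a : ℝ}
    (hf : ∀ i < ⌊t / δ⌋₊, Integrable (fun ω => (f ((i + 1) * δ) ω - f (i * δ) ω) ^ 2) P)
    (hE : ∀ i < ⌊t / δ⌋₊, ∫ ω, (f ((i + 1) * δ) ω - f (i * δ) ω) ^ 2 ∂P =
      E ((i + 1) * δ) - E (i * δ) - a * D (i * δ)) :
    signaturePlot P f t δ = 1 / t * (E (⌊t / δ⌋₊ * δ) - E 0) -
      1 / t * a * ∑ i ∈ Finset.range ⌊t / δ⌋₊, D (i * δ) := by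
  have hsum : ∀ (n : ℕ) (g : ℕ → ℝ), ∑ i ∈ Finset.Icc 1 n, g i = ∑ i ∈ Finset.range n, g (i + 1) :=
    fun n g => by
      induction n with
      | zero => simp
      | succ k ih => rw [Finset.sum_Icc_succ_top (by omega), Finset.sum_range_succ, ih]
  rw [signaturePlot]
  simp only [hsum, Nat.cast_add, Nat.cast_one, add_sub_cancel_right]
  rw [integral_finsetSum _ fun i hi => hf i (Finset.mem_range.1 hi),
    Finset.sum_congr rfl fun i hi => hE i (Finset.mem_range.1 hi), Finset.sum_sub_distrib,
    ← Finset.mul_sum]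
  have htel := Finset.sum_range_sub (fun i : ℕ => E (i * δ)) ⌊t / δ⌋₊
  simp only [Nat.cast_add, Nat.cast_one, Nat.cast_zero, zero_mul] at htel
  rw [htel]
  ring

theorem proposition3p3 {Ω : Type*} [mΩ : MeasurableSpace Ω] (P : Measure Ω)
    [IsProbabilityMeasure P] (ℱ : Filtration ℝ≥0 mΩ)
    (T μ₀ κ α β f₀ : ℝ) (hT : 0 < T) (hμ₀ : 0 < μ₀) (hκ : 0 < κ) (hα : 0 < α) (hβ : 0 < β)
    (τ : ℕ → Ω → ℝ≥0) (ε : ℕ → Ω → Fin 2) (ξ : ℕ → Ω → ℝ) (J : Ω → ℝ)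
    (hN : MarkedHawkes.IsMarkedHawkes P ℱ T (MarkedHawkes.expBaseline μ₀ κ)
      (MarkedHawkes.expKernel α β) τ ε ξ J)
    (m m₂ : ℝ) (hm : m = ∫ ω, J ω ∂P) (hm₂ : m₂ = ∫ ω, J ω ^ 2 ∂P) (hαβ : α * m < β)
    (lam : ℝ → Ω → ℝ)
    (hlam : lam = MarkedHawkes.intensity T (MarkedHawkes.expBaseline μ₀ κ)
      (MarkedHawkes.expKernel α β) τ ε ξ 0)
    (f : ℝ → Ω → ℝ) (hf : f = MarkedHawkes.price f₀ τ ε ξ) :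
    -- the moments that occur are finite, and have the announced closed forms
    (∀ u ∈ Set.Icc 0 T, Integrable (lam u) P ∧
      ∫ ω, lam u ω ∂P = MarkedHawkes.meanIntensity T μ₀ κ α β m u) ∧
    (∀ u ∈ Set.Icc 0 T, MemLp (f u) 2 P ∧
      ∫ ω, f u ω ^ 2 ∂P = MarkedHawkes.secondMoment T μ₀ κ α β m m₂ f₀ u) ∧
    DifferentiableOn ℝ (fun u => ∫ ω, f u ω ^ 2 ∂P) (Set.Icc 0 T) ∧
    -- the second moment of the increments
    (∀ s t : ℝ, 0 ≤ s → s < t → t ≤ T →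
      ∫ ω, (f t ω - f s ω) ^ 2 ∂P =
        ∫ ω, f t ω ^ 2 ∂P - ∫ ω, f s ω ^ 2 ∂P -
          (1 - Real.exp (-(β + α * m) * (t - s))) / (β + α * m) *
            (derivWithin (fun u => ∫ ω, f u ω ^ 2 ∂P) (Set.Icc 0 T) s
              - 2 * m₂ * ∫ ω, lam s ω ∂P)) ∧
    -- the resulting formula for the signature plot
    (∀ t δ : ℝ, 0 < t → t ≤ T → 0 < δ →
      MarkedHawkes.signaturePlot P f t δ =
        1 / t * ((∫ ω, f (⌊t / δ⌋₊ * δ) ω ^ 2 ∂P) - f₀ ^ 2) -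
          1 / t * ((1 - Real.exp (-(β + α * m) * δ)) / (β + α * m)) *
            ∑ i ∈ Finset.range ⌊t / δ⌋₊,
              (derivWithin (fun u => ∫ ω, f u ω ^ 2 ∂P) (Set.Icc 0 T) (i * δ)
                - 2 * m₂ * ∫ ω, lam (i * δ) ω ∂P)) := by
  have hL := hN.memLp_totalMark hT hμ₀ hκ hα hβ
  have hm1 : Measurable fun _ : ℝ => (1 : ℝ) := measurable_const
  have hb1 := MarkedHawkes.exists_bound_one T
  have hX := hN.isDominated_markSum MarkedHawkes.sgn hm1 hb1
  set X := MarkedHawkes.markSum τ ε ξ MarkedHawkes.sgn fun _ => 1 with hXdef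
  have hfX : ∀ t ≤ T, f t = fun ω => f₀ + X t ω := fun t ht => by
    ext ω
    rw [hf, hN.price_eq f₀ ht]
  have hX2 : ∀ t ∈ Set.Icc 0 T, MemLp (X t) 2 P := fun t ht => by
    have := (hX.mul hX).integrable hL ht
    rw [memLp_two_iff_integrable_sq (hX.1.of_uncurry_left).aestronglyMeasurable]
    simpa only [sq] using this
  obtain ⟨p, hp, hr, hderiv⟩ :=
    hN.exists_integral_markSum_sgn_mul hT hμ₀ hκ hα hβ hm hm₂ hαβ f₀
  have hlam_int : ∀ u ∈ Set.Icc 0 T, Integrable (lam u) P ∧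
      ∫ ω, lam u ω ∂P = MarkedHawkes.meanIntensity T μ₀ κ α β m u := fun u hu => by
    have hd := fun c => ((hN.isDominated_combIntensity hT hμ₀ hκ hα hβ c).mono
      hN.totalMark_nonneg one_le_two).integrable hL hu
    have heq : lam u = fun ω => 1 / 2 * (MarkedHawkes.combIntensity T μ₀ κ α β τ ε ξ 1 u ω +
        MarkedHawkes.combIntensity T μ₀ κ α β τ ε ξ MarkedHawkes.sgn u ω) := by
      ext ω
      rw [hlam, MarkedHawkes.intensity_zero_eq_combIntensity]
    rw [heq]
    refine ⟨((hd _).add (hd _)).const_mul _, ?_⟩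
    rw [integral_const_mul, integral_add (hd _) (hd _),
      hN.integral_combIntensity_one hT hμ₀ hκ hα hβ hm hαβ hu,
      hN.integral_combIntensity_sgn hT hμ₀ hκ hα hβ hu]
    ring
  have hf2 : ∀ u ∈ Set.Icc 0 T, MemLp (f u) 2 P ∧
      ∫ ω, f u ω ^ 2 ∂P = MarkedHawkes.secondMoment T μ₀ κ α β m m₂ f₀ u := fun u hu => by
    rw [hfX u hu.2]
    refine ⟨(memLp_const f₀).add (hX2 u hu), ?_⟩
    have h1 : ∀ ω, (f₀ + X u ω) ^ 2 = (f₀ ^ 2 + 2 * f₀ * X u ω) + X u ω * X u ω :=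
      fun ω => by ring
    have hXi : Integrable (fun ω => 2 * f₀ * X u ω) P :=
      ((hX2 u hu).integrable one_le_two).const_mul _
    have hXi' : Integrable (fun ω => f₀ ^ 2 + 2 * f₀ * X u ω) P := (integrable_const _).add hXi
    simp only [h1]
    rw [integral_add hXi' ((hX.mul hX).integrable hL hu),
      integral_add (integrable_const _) hXi, integral_const_mul,
      hN.integral_markSum_sgn hT hμ₀ hκ hα hβ hm1 hb1 hu, hr u hu, integral_const,
      probReal_univ, one_smul]
    ring
  -- The closed form is differentiable on the whole line, which gives the one-sided derivatives at
  -- the end points.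
  have hder : ∀ s ∈ Set.Icc 0 T, HasDerivWithinAt (fun u => ∫ ω, f u ω ^ 2 ∂P)
      (-(2 * (α * m)) * (Real.exp (-β * s) * p s) +
        2 * m₂ * MarkedHawkes.meanIntensity T μ₀ κ α β m s) (Set.Icc 0 T) s := fun s hs =>
    (hderiv s).hasDerivWithinAt.congr (fun u hu => (hf2 u hu).2) (hf2 s hs).2
  have hinc : ∀ s t : ℝ, 0 ≤ s → s < t → t ≤ T →
      ∫ ω, (f t ω - f s ω) ^ 2 ∂P =
        ∫ ω, f t ω ^ 2 ∂P - ∫ ω, f s ω ^ 2 ∂P -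
          (1 - Real.exp (-(β + α * m) * (t - s))) / (β + α * m) *
            (derivWithin (fun u => ∫ ω, f u ω ^ 2 ∂P) (Set.Icc 0 T) s
              - 2 * m₂ * ∫ ω, lam s ω ∂P) := fun s t hs hst ht => by
    have hsT : s ∈ Set.Icc 0 T := ⟨hs, hst.le.trans ht⟩
    have htT : t ∈ Set.Icc 0 T := ⟨hs.trans hst.le, ht⟩
    have hcross := hN.integral_markSum_mul_increment_one hT hμ₀ hκ hα hβ hm hαβ hs hst.le ht
    rw [hp s hsT] at hcross
    rw [(hder s hsT).derivWithin (uniqueDiffOn_Icc hT s hsT), (hf2 t htT).2, (hf2 s hsT).2,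
      (hlam_int s hsT).2, hfX t ht, hfX s hsT.2]
    -- Only E(X_s (X_t - X_s)) is new. By `hcross` it is half of the derivative minus 2m₂ E(λ⁺_s),
    -- times (1 - e^{-(β+αm)(t-s)}) / (β+αm), and the 2 restores the stated factor.
    have h1 : ∀ ω, (f₀ + X t ω - (f₀ + X s ω)) ^ 2 =
        (X t ω * X t ω - X s ω * X s ω) - 2 * (X s ω * (X t ω - X s ω)) := fun ω => by ring
    have hXs := (hX.mul hX).integrable hL hsT
    have hXt := (hX.mul hX).integrable hL htT
    have hXst : Integrable (fun ω => X s ω * (X t ω - X s ω)) P :=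
      (hX2 s hsT).integrable_mul ((hX2 t htT).sub (hX2 s hsT))
    have hXts : Integrable (fun ω => X t ω * X t ω - X s ω * X s ω) P := hXt.sub hXs
    simp only [h1]
    rw [integral_sub hXts (hXst.const_mul 2), integral_sub hXt hXs, integral_const_mul,
      hcross, hr t htT, hr s hsT]
    ring
  refine ⟨hlam_int, hf2, fun s hs => (hder s hs).differentiableWithinAt, hinc,
    fun t δ ht htT hδ => ?_⟩
  have hiT : ∀ i : ℕ, i ≤ ⌊t / δ⌋₊ → (i : ℝ) * δ ∈ Set.Icc 0 T := fun i hi => by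
    refine ⟨by positivity, ?_⟩
    have h1 : (i : ℝ) ≤ t / δ := (Nat.le_floor_iff (by positivity)).1 hi
    exact ((le_div_iff₀ hδ).1 h1).trans htT
  have hf0 : ∫ ω, f 0 ω ^ 2 ∂P = f₀ ^ 2 := by
    rw [(hf2 0 ⟨le_rfl, hT.le⟩).2, MarkedHawkes.secondMoment_zero]
  rw [← hf0]
  refine MarkedHawkes.signaturePlot_eq P f (E := fun u => ∫ ω, f u ω ^ 2 ∂P)
    (D := fun s => derivWithin (fun u => ∫ ω, f u ω ^ 2 ∂P) (Set.Icc 0 T) s -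
      2 * m₂ * ∫ ω, lam s ω ∂P) (fun i hi => ?_) fun i hi => ?_
  · have h1 := hiT i hi.le
    -- On natural numbers `i < n` unfolds to `i + 1 ≤ n`, so the right end point of the interval
    -- also lies in [0, T].
    have h2 := hiT (i + 1) hi
    push_cast at h2
    exact ((hf2 _ h2).1.sub (hf2 _ h1).1).integrable_sq
  · have h1 := hiT i hi.le
    have h2 := hiT (i + 1) hi
    push_cast at h2
    have h3 := hinc (i * δ) ((i + 1) * δ) h1.1 (by linarith) h2.2
    rw [show ((i : ℝ) + 1) * δ - i * δ = δ by ring] at h3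
    exact h3
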